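/- Let $V$ be a finite-dimensional real vector space, $H$ a closed subgroup of $\mathrm{GL}(V)$, and $G=V\rtimes H$ with product $(v,h)(v',h')=(v+h v',hh')$. For a locally compact group $L$ with right Haar measure $dl$ let $\Delta_L$ be the modular function given by $\int_L f(a^{-1}l)\,dl=\Delta_L(a)\int_L f(l)\,dl$ ($a\in L$, $f\in C_c(L)$). Let $\chi$ be a continuous unitary character of $V$, put $(\chi\cdot h)(v)=\chi(hv)$ and $H_\chi=\{h\in H:\chi\cdot h=\chi\}$, and let $\rho$ be an irreducible unitary representation of $H_\chi$ on a complex Hilbert space. Put $N=V\rtimes H_\chi$ and $(\chi\otimes\rho)(v,h)=\chi(v)\rho(h)$ for $(v,h)\in N$. Fix a Haar measure $dv$ on $V$ and right Haar measures $dh$ on $H$ and $dh_0$ on $H_\chi$, and use the right Haar measures $dg=dv\,dh$ on $G$ and $dn=dv\,dh_0$ on $N$. Let $q$ be a strictly positive continuous function on $G$ with $q(e)=1$ and $q(ng)=\Delta_N(n)\Delta_G(n^{-1})q(g)$ for $n\in N$, $g\in G$; it has the form $q(v,h)=Q(h)$. Let $d_q\dot g$ be the measure on the space $G/N$ of right cosets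 $Ng$ with $$\int_{G/N}\Bigl(\int_N f(ng)\,dn\Bigr)d_q\dot g=\int_G f(g)\,q(g)\,dg\qquad(f\in C_c(G)),$$ and let $d_Q\dot h$ be the measure on the space $H/H_\chi$ of right cosets $H_\chi h$ with $\int_{H/H_\chi}\bigl(\int_{H_\chi} f(h_0h)\,dh_0\bigr)d_Q\dot h=\int_H f(h)\,Q(h)\,dh$ for $f\in C_c(H)$. Let $\pi=\pi_{\chi,\rho}=\mathrm{Ind}_N^G(\chi\otimes\rho)$ be the induced representation: it acts on the Hilbert space of (classes of) measurable functions $f$ on $G$ with values in the space of $\rho$ such that $f(ng)=(\chi\otimes\rho)(n)f(g)$ and $\int_{G/N}\|f\|^2\,d_q\dot g<\infty$, by $(\pi(g)f)(x)=f(xg)\,[q(xg)/q(x)]^{1/2}$. Let $\varphi\in C_c(G)$, $\varphi^*(g)=\overline{\varphi(g^{-1})}\,\Delta_G(g^{-1})$, $\psi=\varphi*\varphi^*$, that is, $\psi(x)=\int_G\varphi(xy^{-1})\varphi^*(y)\,dy$, and $\pi(\psi)=\int_G\psi(g)\pi(g)\,dg$. For $h\in H$ let $A(h)$ be the operator $$A(h)=\int_V\int_{H_\chi}\psi(v,h^{-1}h_0h)\,(\chi\cdot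 h)(v)\,\rho(h_0)\,\Delta_H(h_0)^{1/2}\,\Delta_{H_\chi}(h_0)^{-1/2}\,dh_0\,dv$$ on the space of $\rho$. Then $\pi(\psi)$ (an integral that converges strongly) and all the $A(h)$ are positive operators, $\Delta_H(h)^{-1}Q(h)^{-1}\operatorname{tr}A(h)\in[0,\infty]$ depends only on the coset $H_\chi h$ and is a measurable function of it, and $$\operatorname{tr}\pi(\psi)=\int_{H/H_\chi}\Delta_H(h)^{-1}\,Q(h)^{-1}\operatorname{tr}A(h)\;d_Q\dot h$$ in the sense that both sides are finite and equal or both are $+\infty$. -/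

import Mathlib

open MeasureTheory MeasureTheory.Measure
open scoped NNReal ENNReal Pointwise

set_option linter.unusedSectionVars false

namespace Mackey

section General

variable {G : Type*} [Group G] [TopologicalSpace G] [MeasurableSpace G]

/-- Right Haar measures. On the second countable locally compact groups used below such a
measure is automatically regular. -/
class IsRightHaar (μ : Measure G) : Prop
    extends IsMulRightInvariant μ, IsFiniteMeasureOnCompacts μ, IsOpenPosMeasure μ

/-- The space of right cosets `N g`, with its quotient topology and quotient σ-algebra. -/
abbrev RightCosets (N : Subgroup G) : Type _ := Quotient (QuotientGroup.rightRel N)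

/-- The right coset `N g`. -/
abbrev coset (N : Subgroup G) (g : G) : RightCosets N := Quotient.mk (QuotientGroup.rightRel N) g

theorem exists_out_eq (N : Subgroup G) (g : G) : ∃ n : N, (coset N g).out = n * g := by
  have h : (QuotientGroup.rightRel N) (coset N g).out g := Quotient.mk_out g
  rw [QuotientGroup.rightRel_apply] at h
  refine ⟨⟨_, N.inv_mem h⟩, ?_⟩
  simp

theorem apply_out_coset {α : Type*} {N : Subgroup G} {F : G → α}
    (hF : ∀ (n : N) (g : G), F (n * g) = F g) (g : G) : F (coset N g).out = F g := by
  obtain ⟨n, hn⟩ := exists_out_eq N g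
  rw [hn, hF]

theorem measurable_out {α : Type*} [MeasurableSpace α] {N : Subgroup G} {F : G → α}
    (hF : ∀ (n : N) (g : G), F (n * g) = F g) (hm : Measurable F) :
    Measurable fun x : RightCosets N => F x.out := by
  refine measurable_from_quotient.2 ?_
  have : (fun x : RightCosets N => F x.out) ∘ Quotient.mk'' = F := by
    funext g; exact apply_out_coset hF g
  rw [this]; exact hm

/-- `(T_N f)(N g) = ∫_N f (n g) dn`; for right invariant `μN` the integral does not depend on the
representative `g` of the coset. -/
noncomputable def fiberIntegral (N : Subgroup G) (μN : Measure N) (f : G → ℝ)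
    (x : RightCosets N) : ℝ :=
  ∫ n : N, f (n * x.out) ∂μN

/-- `ν` is the measure `d_q` on `N \ G` attached to `q`:
`∫_{N \ G} T_N f d_q = ∫_G f(g) q(g) dg` for all `f ∈ C_c(G)`. -/
def IsQuotientMeasure (N : Subgroup G) (μG : Measure G) (μN : Measure N) (q : G → ℝ)
    (ν : Measure (RightCosets N)) : Prop :=
  ∀ f : G → ℝ, Continuous f → HasCompactSupport f →
    ∫ x, fiberIntegral N μN f x ∂ν = ∫ g, f g * q g ∂μG

variable [IsTopologicalGroup G] [LocallyCompactSpace G]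

instance (N : Subgroup G) [hN : IsClosed (N : Set G)] : LocallyCompactSpace N :=
  hN.isClosedEmbedding_subtypeVal.locallyCompactSpace

instance [SecondCountableTopology G] (N : Subgroup G) : SecondCountableTopology N :=
  TopologicalSpace.Subtype.secondCountableTopology (N : Set G)

/-- The modular function `Δ`, normalised by `∫ f (a⁻¹ g) dg = Δ(a) ∫ f (g) dg` for a right Haar
measure `dg`. -/
noncomputable def modular (g : G) : ℝ := (modularCharacter g : ℝ)

/-- The functions `q` on `G` that define quasi-invariant measures on `N \ G`. -/
structure IsRhoFunction (N : Subgroup G) [IsClosed (N : Set G)] (q : G → ℝ) : Prop where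
  continuous : Continuous q
  pos : ∀ g, 0 < q g
  map_one : q 1 = 1
  map_mul : ∀ (n : N) (g : G), q (n * g) = modular n * modular (n : G)⁻¹ * q g

variable [SecondCountableTopology G] [T2Space G] [BorelSpace G]
variable {N : Subgroup G} [IsClosed (N : Set G)]

theorem integral_inv_mul_left (μ : Measure G) [IsRightHaar μ] (f : G → ℝ) (a : G) :
    ∫ g, f (a⁻¹ * g) ∂μ = modular a * ∫ g, f g ∂μ := by
  have : IsHaarMeasure μ.inv :=
    { map_mul_left_eq_self := fun g => by
        have := (inferInstance : IsMulLeftInvariant μ.inv)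
        exact this.map_mul_left_eq_self g
      lt_top_of_isCompact := fun K hK => by
        rw [Measure.inv_apply]; exact hK.inv.measure_lt_top
      open_pos := (continuous_inv.isOpenPosMeasure_map (μ := μ) inv_surjective).open_pos }
  have h1 : ∀ F : G → ℝ, ∫ y, F y⁻¹ ∂μ.inv = ∫ g, F g ∂μ := fun F => by
    have := integral_map_equiv (μ := μ) (MeasurableEquiv.inv G) (fun y => F y⁻¹)
    simpa [Measure.inv] using this
  have h2 := map_right_mul_eq_modularCharacterFun_smul μ.inv a
  have h3 : ∫ y, f y⁻¹ ∂(Measure.map (· * a) μ.inv) = ∫ y, f (y * a)⁻¹ ∂μ.inv :=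
    integral_map_equiv (MeasurableEquiv.mulRight a) (fun y => f y⁻¹)
  rw [h2, integral_smul_nnreal_measure, h1] at h3
  rw [← h1 fun g => f (a⁻¹ * g)]
  simp only [mul_inv_rev] at h3
  rw [← h3]
  rfl

theorem measurable_fiber (μN : Measure N) [SFinite μN] {F : G → ℝ≥0∞} (hF : Measurable F) :
    Measurable fun g : G => ∫⁻ n : N, F (n * g) ∂μN := by
  apply Measurable.lintegral_prod_right'
    (f := fun p : G × N => F (p.2 * p.1))
  fun_prop

theorem fiber_invariant (μN : Measure N) [IsMulRightInvariant μN] (F : G → ℝ≥0∞) (n₀ : N) (g : G) :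
    ∫⁻ n : N, F (n * (n₀ * g)) ∂μN = ∫⁻ n : N, F (n * g) ∂μN := by
  rw [← lintegral_mul_right_eq_self (μ := μN) (fun n : N => F (n * g)) n₀]
  simp [mul_assoc]

theorem fiberIntegral_coset (μN : Measure N) [IsMulRightInvariant μN] (f : G → ℝ) (g : G) :
    fiberIntegral N μN f (coset N g) = ∫ n : N, f (n * g) ∂μN := by
  refine apply_out_coset (F := fun g => ∫ n : N, f (n * g) ∂μN) (fun n₀ g => ?_) g
  rw [← integral_mul_right_eq_self (μ := μN) (fun n : N => f (n * g)) n₀]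
  simp [mul_assoc]


theorem fiber_compact_le (μN : Measure N) [IsRightHaar μN] {K : Set G} (hK : IsCompact K) :
    ∃ C : ℝ≥0∞, C ≠ ∞ ∧ ∀ g : G, μN {n : N | (n : G) * g ∈ K} ≤ C := by
  have hc : IsCompact (((↑) : N → G) ⁻¹' (K * K⁻¹)) :=
    (IsClosed.isClosedEmbedding_subtypeVal ‹_›).isCompact_preimage (hK.mul hK.inv)
  refine ⟨_, (hc.measure_lt_top (μ := μN)).ne, fun g => ?_⟩
  by_cases h : ∃ n₀ : N, (n₀ : G) * g ∈ K
  · obtain ⟨n₀, h₀⟩ := h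
    rw [← measure_preimage_mul_right μN n₀⁻¹ (((↑) : N → G) ⁻¹' (K * K⁻¹))]
    refine measure_mono fun n hn => ?_
    refine ⟨n * g, hn, (n₀ * g)⁻¹, Set.inv_mem_inv.2 h₀, ?_⟩
    simp
  · have : {n : N | (n : G) * g ∈ K} = ∅ := by
      ext n; simp only [Set.mem_ofPred_eq, Set.mem_empty_iff_false, iff_false]
      exact fun hn => h ⟨n, hn⟩
    simp [this]

/-- A Bruhat function: a measurable weight with all fibre integrals equal to one. -/
theorem exists_bruhat (μN : Measure N) [IsRightHaar μN] :
    ∃ w : G → ℝ≥0∞, Measurable w ∧ ∀ g : G, ∫⁻ n : N, w (n * g) ∂μN = 1 := by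
  let K := CompactExhaustion.choice G
  choose C hC hCle using fun k : ℕ => fiber_compact_le μN (K.isCompact k)
  obtain ⟨δ, hδ, hsum⟩ := ENNReal.exists_pos_tsum_mul_lt_of_countable one_ne_zero C hC
  let w : G → ℝ≥0∞ := fun g => ∑' k, (δ k : ℝ≥0∞) * (K k).indicator 1 g
  have hKm : ∀ k, MeasurableSet (K k) := fun k => (K.isCompact k).measurableSet
  have hw : Measurable w := by
    refine Measurable.tsum fun k => ?_
    exact (measurable_one.indicator (hKm k)).const_mul _
  let W : G → ℝ≥0∞ := fun g => ∫⁻ n : N, w (n * g) ∂μN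
  have hWm : Measurable W := measurable_fiber μN hw
  have hWeq : ∀ g, W g = ∑' k, (δ k : ℝ≥0∞) * μN {n : N | (n : G) * g ∈ K k} := by
    intro g
    have hm : ∀ k, MeasurableSet {n : N | (n : G) * g ∈ K k} := fun k =>
      (by fun_prop : Measurable fun n : N => (n : G) * g) (hKm k)
    simp only [W, w]
    rw [lintegral_tsum]
    · congr 1; funext k
      rw [lintegral_const_mul]
      · congr 1
        rw [← lintegral_indicator_one (hm k)]
        rfl
      · exact (measurable_one.indicator (hKm k)).comp (by fun_prop)
    · intro k
      exact (((measurable_one.indicator (hKm k)).comp (by fun_prop)).const_mul _).aemeasurable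
  have hWtop : ∀ g, W g ≠ ∞ := by
    intro g
    rw [hWeq]
    refine ne_top_of_lt (lt_of_le_of_lt (ENNReal.tsum_le_tsum fun k => ?_) hsum)
    rw [mul_comm]
    gcongr
    exact hCle k g
  have hWpos : ∀ g, W g ≠ 0 := by
    intro g
    obtain ⟨k, hk⟩ := K.exists_mem_nhds g
    have hpos : 0 < μN {n : N | (n : G) * g ∈ K k} := by
      apply measure_pos_of_mem_nhds μN (x := (1 : N))
      have : ContinuousAt (fun n : N => (n : G) * g) 1 := by fun_prop
      exact this (by simpa using hk)
    rw [hWeq]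
    intro h0
    have := (ENNReal.tsum_eq_zero.1 h0) k
    rcases mul_eq_zero.1 this with h | h
    · exact (hδ k).ne' (by exact_mod_cast h)
    · exact hpos.ne' h
  refine ⟨fun g => w g / W g, hw.div hWm, fun g => ?_⟩
  have : ∀ n : N, w (n * g) / W (n * g) = w (n * g) * (W g)⁻¹ := by
    intro n
    rw [div_eq_mul_inv]
    congr 2
    exact fiber_invariant μN w n g
  simp_rw [this]
  rw [lintegral_mul_const _ (by fun_prop)]
  exact ENNReal.mul_inv_cancel (hWpos g) (hWtop g)

/-- The defining identity of `d_q`, extended to nonnegative Borel functions. -/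
theorem IsQuotientMeasure.lintegral_eq {μG : Measure G} [IsRightHaar μG] {μN : Measure N}
    [IsRightHaar μN] {q : G → ℝ} (hq : IsRhoFunction N q) {ν : Measure (RightCosets N)}
    (hν : IsQuotientMeasure N μG μN q ν) {F : G → ℝ≥0∞} (hF : Measurable F) :
    ∫⁻ x : RightCosets N, ∫⁻ n : N, F (n * x.out) ∂μN ∂ν
      = ∫⁻ g, F g * ENNReal.ofReal (q g) ∂μG := by
  let κ : RightCosets N → Measure G := fun x => μN.map fun n : N => (n : G) * x.out
  have hκl : ∀ {f : G → ℝ≥0∞}, Measurable f → ∀ x,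
      ∫⁻ g, f g ∂(κ x) = ∫⁻ n : N, f (n * x.out) ∂μN := by
    intro f hf x
    exact lintegral_map hf (by fun_prop)
  have hκ : Measurable κ := by
    refine Measure.measurable_of_measurable_coe _ fun s hs => ?_
    have : (fun x => κ x s) =
        fun x : RightCosets N => ∫⁻ n : N, s.indicator 1 ((n : G) * x.out) ∂μN := by
      funext x
      rw [← hκl (measurable_one.indicator hs), lintegral_indicator_one hs]
    rw [this]
    exact measurable_out (fun n g => fiber_invariant μN _ n g)
      (measurable_fiber μN (measurable_one.indicator hs))
  let m₁ : Measure G := ν.bind κ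
  let m₂ : Measure G := μG.withDensity fun g => ENNReal.ofReal (q g)
  have hqm : Measurable fun g => ENNReal.ofReal (q g) := hq.continuous.measurable.ennreal_ofReal
  have hm₁ : ∀ {f : G → ℝ≥0∞}, Measurable f →
      ∫⁻ g, f g ∂m₁ = ∫⁻ x : RightCosets N, ∫⁻ n : N, f (n * x.out) ∂μN ∂ν := by
    intro f hf
    rw [Measure.lintegral_bind hκ.aemeasurable hf.aemeasurable]
    exact lintegral_congr fun x => hκl hf x
  have hm₂ : ∀ {f : G → ℝ≥0∞}, Measurable f →
      ∫⁻ g, f g ∂m₂ = ∫⁻ g, f g * ENNReal.ofReal (q g) ∂μG := by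
    intro f hf
    rw [lintegral_withDensity_eq_lintegral_mul _ hqm hf]
    simp [mul_comm]
  -- agreement on nonnegative functions in `C_c(G)`
  have key : ∀ f : G → ℝ, Continuous f → HasCompactSupport f → (∀ g, 0 ≤ f g) →
      ∫⁻ g, ENNReal.ofReal (f g) ∂m₁ = ∫⁻ g, ENNReal.ofReal (f g) ∂m₂ := by
    intro f hf hfc hf0
    have hfm : Measurable fun g => ENNReal.ofReal (f g) := hf.measurable.ennreal_ofReal
    by_cases hz : f = 0
    · simp [hz]
    obtain ⟨g₀, hg₀⟩ := Function.ne_iff.1 hz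
    have hfq : Integrable (fun g => f g * q g) μG :=
      (hf.mul hq.continuous).integrable_of_hasCompactSupport hfc.mul_right
    have hpos : 0 < ∫ g, f g * q g ∂μG := by
      refine (hf.mul hq.continuous).integral_pos_of_hasCompactSupport_nonneg_nonzero
        hfc.mul_right (fun g => mul_nonneg (hf0 g) (hq.pos g).le) (x := g₀) ?_
      exact mul_ne_zero hg₀ (hq.pos g₀).ne'
    have hT : Integrable (fiberIntegral N μN f) ν := by
      by_contra hni
      have := hν f hf hfc
      rw [integral_undef hni] at this
      exact hpos.ne this
    have hTn : ∀ x, 0 ≤ fiberIntegral N μN f x := fun x => integral_nonneg fun n => hf0 _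
    have hint : ∀ x : RightCosets N, Integrable (fun n : N => f (n * x.out)) μN := by
      intro x
      refine Continuous.integrable_of_hasCompactSupport (by fun_prop) ?_
      have h1 : HasCompactSupport fun g : G => f (g * x.out) :=
        hfc.comp_homeomorph (Homeomorph.mulRight x.out)
      exact h1.comp_isClosedEmbedding (IsClosed.isClosedEmbedding_subtypeVal ‹_›)
    rw [hm₁ hfm, hm₂ hfm]
    calc ∫⁻ x : RightCosets N, ∫⁻ n : N, ENNReal.ofReal (f (n * x.out)) ∂μN ∂ν
        = ∫⁻ x : RightCosets N, ENNReal.ofReal (fiberIntegral N μN f x) ∂ν := by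
          refine lintegral_congr fun x => ?_
          rw [fiberIntegral, ofReal_integral_eq_lintegral_ofReal (hint x)
            (Filter.Eventually.of_forall fun n => hf0 _)]
      _ = ENNReal.ofReal (∫ x, fiberIntegral N μN f x ∂ν) :=
          (ofReal_integral_eq_lintegral_ofReal hT (Filter.Eventually.of_forall hTn)).symm
      _ = ENNReal.ofReal (∫ g, f g * q g ∂μG) := by rw [hν f hf hfc]
      _ = ∫⁻ g, ENNReal.ofReal (f g * q g) ∂μG :=
          ofReal_integral_eq_lintegral_ofReal hfq
            (Filter.Eventually.of_forall fun g => mul_nonneg (hf0 g) (hq.pos g).le)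
      _ = ∫⁻ g, ENNReal.ofReal (f g) * ENNReal.ofReal (q g) ∂μG :=
          lintegral_congr fun g => ENNReal.ofReal_mul (hf0 g)
  have hloc₂ : IsLocallyFiniteMeasure m₂ :=
    IsLocallyFiniteMeasure.withDensity_ofReal hq.continuous
  have hfin₁ : IsFiniteMeasureOnCompacts m₁ := by
    refine ⟨fun K hK => ?_⟩
    obtain ⟨f, hf1, -, hfc, hf01⟩ := exists_continuous_one_zero_of_isCompact hK isClosed_empty
      (Set.disjoint_empty K)
    have h1 : m₁ K ≤ ∫⁻ g, ENNReal.ofReal (f g) ∂m₁ := by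
      rw [← lintegral_indicator_one hK.measurableSet]
      refine lintegral_mono fun g => ?_
      by_cases hg : g ∈ K
      · simp [hg, hf1 hg]
      · simp [hg]
    refine h1.trans_lt ?_
    rw [key f f.continuous hfc fun g => (hf01 g).1]
    have : Integrable f m₂ := f.continuous.integrable_of_hasCompactSupport hfc
    exact this.lintegral_lt_top
  have hloc₁ : IsLocallyFiniteMeasure m₁ := isLocallyFiniteMeasure_of_isFiniteMeasureOnCompacts
  have heq : m₁ = m₂ := by
    apply Measure.ext_of_integral_eq_on_compactlySupported_nnreal
    intro f
    have h0 : ∀ g, (0 : ℝ) ≤ f g := fun g => (f g).2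
    have hc : Continuous fun g => (f g : ℝ) := by fun_prop
    have hs : HasCompactSupport fun g => (f g : ℝ) := f.hasCompactSupport.comp_left rfl
    rw [integral_eq_lintegral_of_nonneg_ae (Filter.Eventually.of_forall h0)
        hc.aestronglyMeasurable,
      integral_eq_lintegral_of_nonneg_ae (Filter.Eventually.of_forall h0)
        hc.aestronglyMeasurable, key _ hc hs h0]
  rw [← hm₁ hF, ← hm₂ hF, heq]

theorem IsRhoFunction.ratio_invariant {q : G → ℝ} (hq : IsRhoFunction N q) (a : G) (n : N) (g : G) :
    q (n * g * a) / q (n * g) = q (g * a) / q g := by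
  rw [mul_assoc, hq.map_mul, hq.map_mul]
  have h1 : modular (n : N) * modular (n : G)⁻¹ ≠ 0 := by
    intro h0
    have := hq.map_mul n g
    rw [h0, zero_mul] at this
    exact (hq.pos _).ne' this
  exact mul_div_mul_left _ _ h1

/-- Quasi-invariance of `d_q` under right translations. -/
theorem IsQuotientMeasure.quasiInvariant {μG : Measure G} [IsRightHaar μG] {μN : Measure N}
    [IsRightHaar μN] {q : G → ℝ} (hq : IsRhoFunction N q) {ν : Measure (RightCosets N)}
    (hν : IsQuotientMeasure N μG μN q ν) {F : G → ℝ≥0∞} (hF : Measurable F)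
    (hFN : ∀ (n : N) (g : G), F (n * g) = F g) (a : G) :
    ∫⁻ x : RightCosets N, F (x.out * a) * ENNReal.ofReal (q (x.out * a) / q x.out) ∂ν
      = ∫⁻ x : RightCosets N, F x.out ∂ν := by
  obtain ⟨w, hw, hw1⟩ := exists_bruhat (N := N) μN
  have hqm : Measurable fun g => ENNReal.ofReal (q g) := hq.continuous.measurable.ennreal_ofReal
  have red : ∀ {u F : G → ℝ≥0∞}, Measurable u → Measurable F →
      (∀ (n : N) (g : G), F (n * g) = F g) → (∀ g : G, ∫⁻ n : N, u (n * g) ∂μN = 1) →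
      ∫⁻ x : RightCosets N, F x.out ∂ν = ∫⁻ g, u g * F g * ENNReal.ofReal (q g) ∂μG := by
    intro u F hu hF hFN hu1
    rw [← hν.lintegral_eq hq (F := fun g => u g * F g) (hu.mul hF)]
    refine lintegral_congr fun x => ?_
    simp only [hFN]
    rw [lintegral_mul_const _ (by fun_prop), hu1, one_mul]
  rw [red (u := fun g => w (g * a⁻¹)) (F := F) (by fun_prop) hF hFN (fun g => by
      simpa [mul_assoc] using hw1 (g * a⁻¹)),
    red (u := w) (F := fun g => F (g * a) * ENNReal.ofReal (q (g * a) / q g)) hw ?_ ?_ hw1]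
  · rw [← lintegral_mul_right_eq_self (μ := μG)
      (fun g => w (g * a⁻¹) * F g * ENNReal.ofReal (q g)) a]
    refine lintegral_congr fun g => ?_
    rw [mul_inv_cancel_right, mul_assoc, mul_assoc, mul_assoc, ← ENNReal.ofReal_mul
      (div_pos (hq.pos _) (hq.pos _)).le, div_mul_cancel₀ _ (hq.pos g).ne']
  · have : Measurable fun g => q (g * a) / q g :=
      (hq.continuous.measurable.comp (by fun_prop)).div hq.continuous.measurable
    exact (hF.comp (by fun_prop)).mul this.ennreal_ofReal
  · intro n g
    rw [hq.ratio_invariant, mul_assoc, hFN]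

end General

section Representations

variable {G : Type*} [Group G] [TopologicalSpace G]
variable {E : Type*} [NormedAddCommGroup E] [InnerProductSpace ℂ E]

/-- Unitary representations: strongly continuous homomorphisms into the unitary group. -/
structure UnitaryRep (G : Type*) [Group G] [TopologicalSpace G]
    (E : Type*) [NormedAddCommGroup E] [InnerProductSpace ℂ E] where
  toHom : G →* (E ≃ₗᵢ[ℂ] E)
  continuous_apply : ∀ v : E, Continuous fun g => toHom g v

instance : CoeFun (UnitaryRep G E) fun _ => G → (E ≃ₗᵢ[ℂ] E) := ⟨fun ρ => ρ.toHom⟩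

/-- Topological irreducibility. -/
def UnitaryRep.IsIrreducible (ρ : UnitaryRep G E) : Prop :=
  Nontrivial E ∧ ∀ W : Submodule ℂ E, IsClosed (W : Set E) →
    (∀ g, ∀ w ∈ W, ρ g w ∈ W) → W = ⊥ ∨ W = ⊤

/-- The integrated operator `π(f) v = ∫ f(g) π(g) v dg`. -/
noncomputable def integrated [MeasurableSpace G] (μ : Measure G) (π : G →* (E ≃ₗᵢ[ℂ] E))
    (f : G → ℂ) (v : E) : E :=
  ∫ g, f g • π g v ∂μ

/-- A positive operator: `⟨v, T v⟩` is real and nonnegative for every `v`. -/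
def IsPositiveOp (T : E → E) : Prop :=
  ∀ v : E, 0 ≤ (inner ℂ v (T v)).re ∧ (inner ℂ v (T v)).im = 0

/-- The trace `∑ᵢ ⟨eᵢ, T eᵢ⟩ ∈ [0, ∞]` of a positive operator `T`, along an orthonormal basis of
the Hilbert space (for a positive operator the choice of the basis does not matter). -/
noncomputable def posTrace [CompleteSpace E] (T : E → E) : ℝ≥0∞ :=
  ∑' e : (exists_hilbertBasis ℂ E).choose, ENNReal.ofReal (inner ℂ (e : E) (T e)).re

/-- Convolution with respect to a right Haar measure, so that `π(f₁ ∗ f₂) = π(f₁) π(f₂)`. -/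
noncomputable def conv [MeasurableSpace G] (μ : Measure G) (f₁ f₂ : G → ℂ) (x : G) : ℂ :=
  ∫ y, f₁ (x * y⁻¹) * f₂ y ∂μ

/-- `f*(g) = conj f(g⁻¹) Δ(g⁻¹)`, so that `π(f*)` is the adjoint of `π(f)`. -/
noncomputable def involution [IsTopologicalGroup G] [LocallyCompactSpace G] (f : G → ℂ) (g : G) :
    ℂ :=
  (starRingEnd ℂ) (f g⁻¹) * (modular g⁻¹ : ℂ)

end Representations

section Induced

variable {G : Type*} [Group G] [TopologicalSpace G] [MeasurableSpace G]
variable {N : Subgroup G}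
variable {E : Type*} [NormedAddCommGroup E] [InnerProductSpace ℂ E]

theorem enorm_sq_add_le (a b : E) : ‖a + b‖ₑ ^ 2 ≤ 2 * (‖a‖ₑ ^ 2 + ‖b‖ₑ ^ 2) := by
  have h : ‖a + b‖ ^ 2 ≤ 2 * (‖a‖ ^ 2 + ‖b‖ ^ 2) := by
    have := norm_add_le a b
    nlinarith [norm_nonneg (a + b), norm_nonneg a, norm_nonneg b, sq_nonneg (‖a‖ - ‖b‖)]
  have h' : ‖a + b‖₊ ^ 2 ≤ 2 * (‖a‖₊ ^ 2 + ‖b‖₊ ^ 2) := by exact_mod_cast h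
  simp only [enorm_eq_nnnorm]
  exact_mod_cast h'

theorem norm_invariant {γ : UnitaryRep N E} {f : G → E}
    (hf : ∀ (n : N) (g : G), f (n * g) = γ n (f g)) (n : N) (g : G) :
    ‖f (n * g)‖ₑ ^ 2 = ‖f g‖ₑ ^ 2 := by
  rw [hf]; simp [enorm_eq_nnnorm]

/-- Measurable functions `f : G → E` with `f(n g) = γ(n) f(g)` and
`∫_{N \ G} ‖f(ġ)‖² dν(ġ) < ∞`. -/
def indSubmodule (γ : UnitaryRep N E) (ν : Measure (RightCosets N)) : Submodule ℂ (G → E) where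
  carrier := {f | StronglyMeasurable f ∧ (∀ (n : N) (g : G), f (n * g) = γ n (f g)) ∧
    ∫⁻ x : RightCosets N, ‖f x.out‖ₑ ^ 2 ∂ν < ∞}
  zero_mem' := ⟨stronglyMeasurable_zero, by simp, by simp⟩
  add_mem' := by
    rintro f g ⟨hf, hfN, hf2⟩ ⟨hg, hgN, hg2⟩
    refine ⟨hf.add hg, fun n x => by simp [hfN, hgN], ?_⟩
    have hm : Measurable fun x : RightCosets N => ‖f x.out‖ₑ ^ 2 :=
      measurable_out (norm_invariant hfN) (hf.enorm.pow_const 2)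
    calc ∫⁻ x : RightCosets N, ‖(f + g) x.out‖ₑ ^ 2 ∂ν
        ≤ ∫⁻ x : RightCosets N, 2 * (‖f x.out‖ₑ ^ 2 + ‖g x.out‖ₑ ^ 2) ∂ν :=
          lintegral_mono fun x => enorm_sq_add_le _ _
      _ = 2 * (∫⁻ x : RightCosets N, ‖f x.out‖ₑ ^ 2 ∂ν
            + ∫⁻ x : RightCosets N, ‖g x.out‖ₑ ^ 2 ∂ν) := by
          rw [lintegral_const_mul' _ _ (by simp), lintegral_add_left hm]
      _ < ∞ := ENNReal.mul_lt_top (by simp) (ENNReal.add_lt_top.2 ⟨hf2, hg2⟩)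
  smul_mem' := by
    rintro c f ⟨hf, hfN, hf2⟩
    refine ⟨hf.const_smul c, fun n x => by simp [hfN], ?_⟩
    simp only [Pi.smul_apply, enorm_smul, mul_pow]
    rw [lintegral_const_mul' _ _ (by simp)]
    exact ENNReal.mul_lt_top (by simp) hf2

/-- The pre-Hilbert space of square integrable `γ`-equivariant functions. -/
def IndPre (γ : UnitaryRep N E) (ν : Measure (RightCosets N)) : Type _ := indSubmodule γ ν

namespace IndPre

variable {γ : UnitaryRep N E} {ν : Measure (RightCosets N)}

noncomputable instance : AddCommGroup (IndPre γ ν) := inferInstanceAs (AddCommGroup (indSubmodule γ ν))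

noncomputable instance : Module ℂ (IndPre γ ν) := inferInstanceAs (Module ℂ (indSubmodule γ ν))

instance : CoeFun (IndPre γ ν) fun _ => G → E := ⟨fun f => f.1⟩

theorem add_apply (f g : IndPre γ ν) (x : G) : (f + g) x = f x + g x := rfl

theorem smul_apply (c : ℂ) (f : IndPre γ ν) (x : G) : (c • f) x = c • f x := rfl

theorem equivariant (f : IndPre γ ν) (n : N) (g : G) : f (n * g) = γ n (f g) := f.2.2.1 n g

theorem integrable_inner (f g : IndPre γ ν) :
    Integrable (fun x : RightCosets N => inner ℂ (f x.out) (g x.out)) ν := by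
  have hm : Measurable fun x : RightCosets N => inner ℂ (f x.out) (g x.out) := by
    refine measurable_out (F := fun x => inner ℂ (f x) (g x)) (fun n x => ?_)
      (f.2.1.inner g.2.1).measurable
    rw [equivariant, equivariant, LinearIsometryEquiv.inner_map_map]
  have hmf : Measurable fun x : RightCosets N => ‖f x.out‖ₑ ^ 2 :=
    measurable_out (norm_invariant f.2.2.1) (f.2.1.enorm.pow_const 2)
  refine ⟨hm.aestronglyMeasurable, ?_⟩
  refine lt_of_le_of_lt (lintegral_mono (g := fun x : RightCosets N =>
    ‖f x.out‖ₑ ^ 2 + ‖g x.out‖ₑ ^ 2) fun x => ?_) ?_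
  · have h : ‖inner ℂ (f x.out) (g x.out)‖ ≤ ‖f x.out‖ ^ 2 + ‖g x.out‖ ^ 2 := by
      have := norm_inner_le_norm (𝕜 := ℂ) (f x.out) (g x.out)
      nlinarith [sq_nonneg (‖f x.out‖ - ‖g x.out‖), sq_nonneg ‖f x.out‖, sq_nonneg ‖g x.out‖]
    have h' : ‖inner ℂ (f x.out) (g x.out)‖₊ ≤ ‖f x.out‖₊ ^ 2 + ‖g x.out‖₊ ^ 2 := by
      exact_mod_cast h
    simp only [enorm_eq_nnnorm]
    exact_mod_cast h'
  · rw [lintegral_add_left hmf]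
    exact ENNReal.add_lt_top.2 ⟨f.2.2.2, g.2.2.2⟩

/-- The inner product `⟨f, g⟩ = ∫_{N \ G} ⟨f(ġ), g(ġ)⟩ dν(ġ)`. -/
noncomputable instance core : PreInnerProductSpace.Core ℂ (IndPre γ ν) where
  inner f g := ∫ x : RightCosets N, inner ℂ (f x.out) (g x.out) ∂ν
  conj_inner_symm f g := by
    rw [← integral_conj]
    simp
  re_inner_nonneg f := by
    have h : (∫ x : RightCosets N, inner ℂ (f x.out) (f x.out) ∂ν)
        = ((∫ x : RightCosets N, ‖f x.out‖ ^ 2 ∂ν : ℝ) : ℂ) := by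
      rw [← integral_complex_ofReal]
      congr 1; funext x
      rw [inner_self_eq_norm_sq_to_K]; simp
    rw [h]
    simpa using integral_nonneg fun x => sq_nonneg _
  add_left f g h := by
    simp only [add_apply, inner_add_left]
    exact integral_add (integrable_inner f h) (integrable_inner g h)
  smul_left f g c := by
    simp only [smul_apply, inner_smul_left]
    exact integral_const_mul _ _

noncomputable instance : SeminormedAddCommGroup (IndPre γ ν) :=
  InnerProductSpace.Core.toSeminormedAddCommGroup (𝕜 := ℂ)

noncomputable instance : InnerProductSpace ℂ (IndPre γ ν) := InnerProductSpace.ofCore core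

theorem inner_def (f g : IndPre γ ν) :
    inner ℂ f g = ∫ x : RightCosets N, inner ℂ (f x.out) (g x.out) ∂ν := rfl

theorem enorm_sq_eq (f : IndPre γ ν) :
    ‖f‖ₑ ^ 2 = ∫⁻ x : RightCosets N, ‖f x.out‖ₑ ^ 2 ∂ν := by
  have h1 : ‖f‖ ^ 2 = ∫ x : RightCosets N, ‖f x.out‖ ^ 2 ∂ν := by
    have h : (inner ℂ f f) = ((∫ x : RightCosets N, ‖f x.out‖ ^ 2 ∂ν : ℝ) : ℂ) := by
      rw [inner_def, ← integral_complex_ofReal]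
      congr 1; funext x
      rw [inner_self_eq_norm_sq_to_K]; simp
    rw [inner_self_eq_norm_sq_to_K] at h
    apply Complex.ofReal_injective
    rw [← h, Complex.ofReal_pow]
    rfl
  have hi : Integrable (fun x : RightCosets N => ‖f x.out‖ ^ 2) ν := by
    have := (integrable_inner f f).norm
    simpa [inner_self_eq_norm_sq_to_K] using this
  have h2 : ‖f‖ₑ ^ 2 = ENNReal.ofReal (‖f‖ ^ 2) := by
    rw [ENNReal.ofReal_pow (norm_nonneg _), ofReal_norm]
  rw [h2, h1, ofReal_integral_eq_lintegral_ofReal hi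
    (Filter.Eventually.of_forall fun x => sq_nonneg _)]
  refine lintegral_congr fun x => ?_
  rw [ENNReal.ofReal_pow (norm_nonneg _), ofReal_norm]

end IndPre

/-- The Hilbert space of the induced representation: square integrable `γ`-equivariant functions
modulo null functions. The pre-Hilbert space `IndPre` is already complete up to null functions,
so that passing to the Hausdorff completion only divides out the latter. -/
abbrev IndSpace (γ : UnitaryRep N E) (ν : Measure (RightCosets N)) : Type _ :=
  UniformSpace.Completion (IndPre γ ν)

variable [IsTopologicalGroup G] [LocallyCompactSpace G]
variable [SecondCountableTopology G] [T2Space G] [BorelSpace G] [IsClosed (N : Set G)]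
variable {μG : Measure G} [IsRightHaar μG] {μN : Measure N} [IsRightHaar μN]
variable {q : G → ℝ} {ν : Measure (RightCosets N)}

/-- `(π(a) f)(x) = f(x a) [q(x a) / q(x)]^{1/2}`. -/
noncomputable def translate (q : G → ℝ) (a : G) (f : G → E) (x : G) : E :=
  ((Real.sqrt (q (x * a) / q x) : ℝ) : ℂ) • f (x * a)

theorem enorm_sq_translate (hq : IsRhoFunction N q) (a : G) (f : G → E) (x : G) :
    ‖translate q a f x‖ₑ ^ 2 = ‖f (x * a)‖ₑ ^ 2 * ENNReal.ofReal (q (x * a) / q x) := by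
  have h0 : 0 ≤ q (x * a) / q x := (div_pos (hq.pos _) (hq.pos _)).le
  rw [translate, enorm_smul, mul_pow, mul_comm]
  congr 1
  rw [← ofReal_norm, ← ENNReal.ofReal_pow (norm_nonneg _), Complex.norm_real, Real.norm_eq_abs,
    sq_abs, Real.sq_sqrt h0]

theorem lintegral_translate {γ : UnitaryRep N E} (hq : IsRhoFunction N q)
    (hν : IsQuotientMeasure N μG μN q ν) (a : G) (f : IndPre γ ν) :
    ∫⁻ x : RightCosets N, ‖translate q a f x.out‖ₑ ^ 2 ∂ν
      = ∫⁻ x : RightCosets N, ‖f x.out‖ₑ ^ 2 ∂ν := by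
  simp_rw [enorm_sq_translate hq]
  exact hν.quasiInvariant hq (F := fun g => ‖f g‖ₑ ^ 2) (f.2.1.enorm.pow_const 2)
    (norm_invariant f.2.2.1) a

theorem translate_mem {γ : UnitaryRep N E} (hq : IsRhoFunction N q)
    (hν : IsQuotientMeasure N μG μN q ν) (a : G) (f : IndPre γ ν) :
    translate q a f ∈ indSubmodule γ ν := by
  refine ⟨?_, fun n x => ?_, ?_⟩
  · have h : Continuous fun x => ((Real.sqrt (q (x * a) / q x) : ℝ) : ℂ) := by
      have h1 : Continuous fun x => q (x * a) / q x :=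
        (hq.continuous.comp (by fun_prop)).div hq.continuous fun x => (hq.pos x).ne'
      exact Complex.continuous_ofReal.comp (Real.continuous_sqrt.comp h1)
    exact h.stronglyMeasurable.smul (f.2.1.comp_measurable (by fun_prop))
  · simp only [translate]
    rw [hq.ratio_invariant, mul_assoc, f.equivariant, map_smul]
  · rw [lintegral_translate hq hν]
    exact f.2.2.2

theorem translate_one (hq : IsRhoFunction N q) (f : G → E) : translate q 1 f = f := by
  funext x
  simp [translate, div_self (hq.pos x).ne']

theorem translate_mul (hq : IsRhoFunction N q) (a b : G) (f : G → E) :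
    translate q (a * b) f = translate q a (translate q b f) := by
  funext x
  simp only [translate, smul_smul, ← mul_assoc]
  congr 1
  rw [← Complex.ofReal_mul, ← Real.sqrt_mul (div_pos (hq.pos _) (hq.pos _)).le]
  congr 2
  have h1 := (hq.pos (x * a)).ne'
  have h2 := (hq.pos x).ne'
  field_simp

/-- The action of `a : G` on the pre-Hilbert space, as a linear isometry. -/
noncomputable def indPreMap (γ : UnitaryRep N E) (hq : IsRhoFunction N q)
    (hν : IsQuotientMeasure N μG μN q ν) (a : G) : IndPre γ ν →ₗᵢ[ℂ] IndPre γ ν where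
  toFun f := ⟨translate q a f, translate_mem hq hν a f⟩
  map_add' f g := by
    apply Subtype.ext; funext x
    exact smul_add _ _ _
  map_smul' c f := by
    apply Subtype.ext; funext x
    exact smul_comm _ _ _
  norm_map' f := by
    let F : IndPre γ ν := ⟨translate q a f, translate_mem hq hν a f⟩
    have h : ‖F‖ₑ ^ 2 = ‖f‖ₑ ^ 2 := by
      rw [IndPre.enorm_sq_eq, IndPre.enorm_sq_eq]
      exact lintegral_translate hq hν a f
    have h' := (ENNReal.pow_right_strictMono two_ne_zero).injective h
    have h'' := congrArg ENNReal.toReal h'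
    rwa [toReal_enorm, toReal_enorm] at h''

/-- The action of `a : G` on the Hilbert space. -/
noncomputable def indMap (γ : UnitaryRep N E) (hq : IsRhoFunction N q)
    (hν : IsQuotientMeasure N μG μN q ν) (a : G) : IndSpace γ ν →L[ℂ] IndSpace γ ν :=
  (indPreMap γ hq hν a).toContinuousLinearMap.completion

theorem indMap_coe (γ : UnitaryRep N E) (hq : IsRhoFunction N q)
    (hν : IsQuotientMeasure N μG μN q ν) (a : G) (f : IndPre γ ν) :
    indMap γ hq hν a (f : IndSpace γ ν) = (indPreMap γ hq hν a f : IndPre γ ν) :=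
  ContinuousLinearMap.completion_apply_coe _ f

theorem indMap_one (γ : UnitaryRep N E) (hq : IsRhoFunction N q)
    (hν : IsQuotientMeasure N μG μN q ν) (v : IndSpace γ ν) : indMap γ hq hν 1 v = v := by
  induction v using UniformSpace.Completion.induction_on with
  | hp => exact isClosed_eq (indMap γ hq hν 1).continuous continuous_id
  | ih f =>
    rw [indMap_coe]
    congr 1
    exact Subtype.ext (translate_one hq f)

theorem indMap_mul (γ : UnitaryRep N E) (hq : IsRhoFunction N q)
    (hν : IsQuotientMeasure N μG μN q ν) (a b : G) (v : IndSpace γ ν) :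
    indMap γ hq hν (a * b) v = indMap γ hq hν a (indMap γ hq hν b v) := by
  induction v using UniformSpace.Completion.induction_on with
  | hp =>
    exact isClosed_eq (indMap γ hq hν (a * b)).continuous
      ((indMap γ hq hν a).continuous.comp (indMap γ hq hν b).continuous)
  | ih f =>
    rw [indMap_coe, indMap_coe, indMap_coe]
    congr 1
    exact Subtype.ext (translate_mul hq a b f)

theorem norm_indMap (γ : UnitaryRep N E) (hq : IsRhoFunction N q)
    (hν : IsQuotientMeasure N μG μN q ν) (a : G) (v : IndSpace γ ν) :
    ‖indMap γ hq hν a v‖ = ‖v‖ := by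
  induction v using UniformSpace.Completion.induction_on with
  | hp => exact isClosed_eq (indMap γ hq hν a).continuous.norm continuous_norm
  | ih f =>
    rw [indMap_coe, UniformSpace.Completion.norm_coe, UniformSpace.Completion.norm_coe]
    exact (indPreMap γ hq hν a).norm_map f

/-- The induced representation `Ind_N^G γ`. -/
noncomputable def inducedRep (γ : UnitaryRep N E) (hq : IsRhoFunction N q)
    (hν : IsQuotientMeasure N μG μN q ν) : G →* (IndSpace γ ν ≃ₗᵢ[ℂ] IndSpace γ ν) where
  toFun a :=
    { toFun := indMap γ hq hν a
      map_add' := map_add _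
      map_smul' := map_smul _
      invFun := indMap γ hq hν a⁻¹
      left_inv := fun v => by rw [← indMap_mul, inv_mul_cancel, indMap_one]
      right_inv := fun v => by rw [← indMap_mul, mul_inv_cancel, indMap_one]
      norm_map' := norm_indMap γ hq hν a }
  map_one' := by ext v; exact indMap_one γ hq hν v
  map_mul' a b := by ext v; exact indMap_mul γ hq hν a b v

end Induced

section Semidirect

variable {V : Type*} [NormedAddCommGroup V] [NormedSpace ℝ V] [FiniteDimensional ℝ V]

/-- The group `GL(V)` of invertible continuous linear maps, with the topology of a unit group. -/
abbrev GLGroup (V : Type*) [NormedAddCommGroup V] [NormedSpace ℝ V] : Type _ := (V →L[ℝ] V)ˣ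

instance : SecondCountableTopology (V →L[ℝ] V) := secondCountable_of_proper

instance : SecondCountableTopology (GLGroup V) :=
  Units.isEmbedding_embedProduct.secondCountableTopology

instance : BorelSpace (GLGroup V) := by
  constructor
  have : CompleteSpace V := FiniteDimensional.complete ℝ V
  have h := (Units.isOpenEmbedding_val (R := V →L[ℝ] V)).eq_induced
  rw [h, borel_comap]
  rfl

/-- The semidirect product `V ⋊ H`, on the set `V × H`. -/
def SemiProd (H : Subgroup (GLGroup V)) : Type _ := V × H

namespace SemiProd

variable {H : Subgroup (GLGroup V)}

/-- The element `(v, h)` of `V ⋊ H`. -/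
def mk (v : V) (h : H) : SemiProd H := (v, h)

/-- `(v, h)(v', h') = (v + h v', h h')`. -/
instance : Mul (SemiProd H) :=
  ⟨fun a b => mk (a.1 + (a.2 : GLGroup V).val b.1) (a.2 * b.2)⟩

instance : One (SemiProd H) := ⟨mk 0 1⟩

instance : Inv (SemiProd H) :=
  ⟨fun a => mk (-((a.2⁻¹ : H) : GLGroup V).val a.1) a.2⁻¹⟩

theorem mul_fst (a b : SemiProd H) : (a * b).1 = a.1 + (a.2 : GLGroup V).val b.1 := rfl

theorem mul_snd (a b : SemiProd H) : (a * b).2 = a.2 * b.2 := rfl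

theorem one_fst : (1 : SemiProd H).1 = 0 := rfl

theorem one_snd : (1 : SemiProd H).2 = 1 := rfl

theorem inv_fst (a : SemiProd H) : a⁻¹.1 = -((a.2⁻¹ : H) : GLGroup V).val a.1 := rfl

theorem inv_snd (a : SemiProd H) : a⁻¹.2 = a.2⁻¹ := rfl

instance : Group (SemiProd H) :=
  Group.ofLeftAxioms
    (fun a b c => by
      refine Prod.ext ?_ (mul_assoc a.2 b.2 c.2)
      simp [mul_fst, mul_snd, add_assoc])
    (fun a => by
      refine Prod.ext ?_ (one_mul a.2)
      simp [mul_fst, one_fst, one_snd])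
    (fun a => by
      refine Prod.ext ?_ (inv_mul_cancel a.2)
      simp only [mul_fst, one_fst, inv_fst, inv_snd]
      simp)

noncomputable instance : TopologicalSpace (SemiProd H) := inferInstanceAs (TopologicalSpace (V × H))

theorem continuous_act : Continuous fun p : H × V => (p.1 : GLGroup V).val p.2 := by
  have h1 : Continuous fun p : H × V => (p.1 : GLGroup V).val :=
    Units.continuous_val.comp (continuous_subtype_val.comp continuous_fst)
  exact h1.clm_apply continuous_snd

instance : IsTopologicalGroup (SemiProd H) where
  continuous_mul := by
    have h1 : Continuous fun p : (V × H) × (V × H) => (p.1.2 : GLGroup V).val p.2.1 :=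
      continuous_act.comp (Continuous.prodMk (by fun_prop) (by fun_prop))
    exact Continuous.prodMk (Continuous.add (by fun_prop) h1)
      (show Continuous fun p : (V × H) × (V × H) => p.1.2 * p.2.2 by fun_prop)
  continuous_inv := by
    have h1 : Continuous fun p : V × H => ((p.2⁻¹ : H) : GLGroup V).val p.1 :=
      continuous_act.comp (Continuous.prodMk (by fun_prop) (by fun_prop))
    exact Continuous.prodMk h1.neg (show Continuous fun p : V × H => p.2⁻¹ by fun_prop)

instance [IsClosed (H : Set (GLGroup V))] : LocallyCompactSpace (SemiProd H) :=
  inferInstanceAs (LocallyCompactSpace (V × H))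

instance : SecondCountableTopology (SemiProd H) :=
  haveI : SecondCountableTopology V := secondCountable_of_proper
  inferInstanceAs (SecondCountableTopology (V × H))

instance : T2Space (SemiProd H) := inferInstanceAs (T2Space (V × H))

/-- For a subgroup `K` of `H`, the subgroup `V ⋊ K` of `V ⋊ H`. -/
def sub (K : Subgroup H) : Subgroup (SemiProd H) where
  carrier := {g | g.2 ∈ K}
  mul_mem' := fun ha hb => K.mul_mem ha hb
  one_mem' := K.one_mem
  inv_mem' := fun ha => K.inv_mem ha

instance (K : Subgroup H) [hK : IsClosed (K : Set H)] : IsClosed (sub K : Set (SemiProd H)) :=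
  hK.preimage (show Continuous fun p : V × H => p.2 from continuous_snd)

/-- The element `(v, k)` of `V ⋊ K`. -/
def subMk (K : Subgroup H) (p : V × K) : sub K := ⟨mk p.1 (p.2 : H), p.2.2⟩

theorem continuous_subMk (K : Subgroup H) : Continuous (subMk K) :=
  Continuous.subtype_mk (show Continuous fun p : V × K => (p.1, (p.2 : H)) by fun_prop) _

/-- The identification of `V × K` with `V ⋊ K`. -/
def subHomeo (K : Subgroup H) : V × K ≃ₜ sub K where
  toFun := subMk K
  invFun g := (g.1.1, ⟨g.1.2, g.2⟩)
  left_inv p := rfl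
  right_inv g := rfl
  continuous_toFun := continuous_subMk K
  continuous_invFun := by
    have h1 : Continuous fun g : sub K => g.1.1 :=
      (show Continuous fun p : V × H => p.1 from continuous_fst).comp continuous_subtype_val
    have h2 : Continuous fun g : sub K => g.1.2 :=
      (show Continuous fun p : V × H => p.2 from continuous_snd).comp continuous_subtype_val
    exact h1.prodMk (h2.subtype_mk _)

variable [MeasurableSpace V]

instance : MeasurableSpace (SemiProd H) := inferInstanceAs (MeasurableSpace (V × H))

variable [BorelSpace V]

instance : BorelSpace (SemiProd H) :=
  haveI : SecondCountableTopology V := secondCountable_of_proper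
  inferInstanceAs (BorelSpace (V × H))

/-- The measure `dg = dv dh` on `V ⋊ H`. -/
noncomputable def haar (μV : Measure V) (μH : Measure H) : Measure (SemiProd H) := μV.prod μH

instance isRightHaar_haar [IsClosed (H : Set (GLGroup V))] (μV : Measure V)
    [μV.IsAddHaarMeasure] (μH : Measure H) [IsRightHaar μH] : IsRightHaar (haar μV μH) where
  map_mul_right_eq_self b := by
    have : SecondCountableTopology V := secondCountable_of_proper
    have hmul : Measurable fun a : SemiProd H => a * b := by fun_prop
    ext s hs
    rw [Measure.map_apply hmul hs]
    have hm : ∀ {t : Set (SemiProd H)}, MeasurableSet t →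
        haar μV μH t = ∫⁻ h : H, μV ((fun v => mk v h) ⁻¹' t) ∂μH := fun ht =>
      Measure.prod_apply_symm ht
    rw [hm (hmul hs), hm hs, ← lintegral_mul_right_eq_self (μ := μH)
      (fun h => μV ((fun v => mk v h) ⁻¹' s)) b.2]
    refine lintegral_congr fun h => ?_
    rw [← measure_preimage_add_right μV ((h : GLGroup V).val b.1) ((fun v => mk v (h * b.2)) ⁻¹' s)]
    rfl
  lt_top_of_isCompact :=
    haveI : SecondCountableTopology V := secondCountable_of_proper
    (inferInstance : IsFiniteMeasureOnCompacts (μV.prod μH)).lt_top_of_isCompact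
  open_pos :=
    haveI : SecondCountableTopology V := secondCountable_of_proper
    (inferInstance : IsOpenPosMeasure (μV.prod μH)).open_pos

/-- The measure `dv dk` on `V ⋊ K`. -/
noncomputable def subHaar (K : Subgroup H) (μV : Measure V) (μK : Measure K) :
    Measure (sub K) := (μV.prod μK).map (subMk K)

instance isRightHaar_subHaar [IsClosed (H : Set (GLGroup V))] (K : Subgroup H)
    [IsClosed (K : Set H)] (μV : Measure V) [μV.IsAddHaarMeasure] (μK : Measure K)
    [IsRightHaar μK] : IsRightHaar (subHaar K μV μK) where
  map_mul_right_eq_self b := by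
    have : SecondCountableTopology V := secondCountable_of_proper
    have hmul : Measurable fun a : sub K => a * b := by fun_prop
    have hmk : Measurable (subMk K) := (continuous_subMk K).measurable
    ext s hs
    rw [Measure.map_apply hmul hs]
    have hm : ∀ {t : Set (sub K)}, MeasurableSet t →
        subHaar K μV μK t = ∫⁻ k : K, μV ((fun v => subMk K (v, k)) ⁻¹' t) ∂μK := fun ht => by
      rw [subHaar, Measure.map_apply hmk ht]
      exact Measure.prod_apply_symm (hmk ht)
    let b₂ : K := ⟨b.1.2, b.2⟩
    rw [hm (hmul hs), hm hs, ← lintegral_mul_right_eq_self (μ := μK)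
      (fun k => μV ((fun v => subMk K (v, k)) ⁻¹' s)) b₂]
    refine lintegral_congr fun k => ?_
    rw [← measure_preimage_add_right μV (((k : H) : GLGroup V).val b.1.1)
      ((fun v => subMk K (v, k * b₂)) ⁻¹' s)]
    rfl
  lt_top_of_isCompact C hC := by
    have : SecondCountableTopology V := secondCountable_of_proper
    rw [subHaar, Measure.map_apply (continuous_subMk K).measurable hC.measurableSet]
    exact ((subHomeo K).isCompact_preimage.2 hC).measure_lt_top
  open_pos := by
    have : SecondCountableTopology V := secondCountable_of_proper
    exact ((continuous_subMk K).isOpenPosMeasure_map (subHomeo K).surjective).open_pos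

end SemiProd

/-- Continuous unitary characters of the vector group `V`. -/
abbrev Character (V : Type*) [NormedAddCommGroup V] : Type _ := Multiplicative V →ₜ* Circle

namespace Character

/-- The value `χ(v)`. -/
noncomputable def eval (χ : Character V) (v : V) : Circle := χ (Multiplicative.ofAdd v)

theorem eval_add (χ : Character V) (v w : V) : χ.eval (v + w) = χ.eval v * χ.eval w := by
  simp [eval]

theorem eval_zero (χ : Character V) : χ.eval 0 = 1 := by
  simp [eval]

theorem continuous_eval (χ : Character V) : Continuous χ.eval :=
  χ.continuous_toFun.comp continuous_ofAdd

/-- The character `χ · h : v ↦ χ(h v)`. -/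
noncomputable def twist (χ : Character V) (h : GLGroup V) : Character V where
  toFun v := χ.eval (h.val v.toAdd)
  map_one' := by simp [eval]
  map_mul' v w := by simp [eval]
  continuous_toFun :=
    χ.continuous_eval.comp (h.val.continuous.comp continuous_toAdd)

theorem eval_twist (χ : Character V) (h : GLGroup V) (v : V) :
    (χ.twist h).eval v = χ.eval (h.val v) := rfl

theorem twist_mul (χ : Character V) (h k : GLGroup V) : χ.twist (h * k) = (χ.twist h).twist k := rfl

theorem twist_one (χ : Character V) : χ.twist 1 = χ := rfl

/-- The stability subgroup `H_χ = {h ∈ H : χ · h = χ}`. -/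
def stab (χ : Character V) (H : Subgroup (GLGroup V)) : Subgroup H where
  carrier := {h | χ.twist (h : GLGroup V) = χ}
  mul_mem' := fun {a b} (ha : χ.twist a = χ) (hb : χ.twist b = χ) => by
    change χ.twist (a * b : GLGroup V) = χ
    rw [twist_mul, ha, hb]
  one_mem' := twist_one χ
  inv_mem' := fun {a} (ha : χ.twist a = χ) => by
    change χ.twist (a⁻¹ : GLGroup V) = χ
    conv_lhs => rw [← ha]
    rw [← twist_mul, mul_inv_cancel, twist_one]

theorem eval_of_mem_stab {H : Subgroup (GLGroup V)} {χ : Character V} {h : H} (hh : h ∈ χ.stab H)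
    (v : V) : χ.eval ((h : GLGroup V).val v) = χ.eval v := by
  rw [← eval_twist]
  exact congrArg (fun c : Character V => c.eval v) hh

instance (H : Subgroup (GLGroup V)) (χ : Character V) : IsClosed (χ.stab H : Set H) := by
  have : (χ.stab H : Set H) = ⋂ v : V, {h : H | χ.eval ((h : GLGroup V).val v) = χ.eval v} := by
    ext h
    simp only [Set.mem_iInter]
    refine ⟨fun hh v => eval_of_mem_stab hh v, fun hh => ?_⟩
    refine DFunLike.ext (χ.twist (h : GLGroup V)) χ fun v => ?_
    have := hh v.toAdd
    rw [Set.mem_ofPred_eq] at this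
    exact this
  rw [this]
  refine isClosed_iInter fun v => isClosed_eq (χ.continuous_eval.comp ?_) continuous_const
  exact SemiProd.continuous_act.comp (continuous_id.prodMk continuous_const)

variable {E : Type*} [NormedAddCommGroup E] [InnerProductSpace ℂ E]

/-- Multiplication by a complex number of modulus one, as a unitary operator. -/
noncomputable def circleUnitary : Circle →* (E ≃ₗᵢ[ℂ] E) where
  toFun z :=
    { toFun := fun v => z • v
      map_add' := smul_add _
      map_smul' := fun c v => smul_comm _ _ _
      invFun := fun v => z⁻¹ • v
      left_inv := fun v => inv_smul_smul z v
      right_inv := fun v => smul_inv_smul z v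
      norm_map' := fun v => by
        change ‖z • v‖ = ‖v‖
        rw [Circle.smul_def, norm_smul, Circle.norm_coe, one_mul] }
  map_one' := by ext v; exact one_smul Circle v
  map_mul' z w := by ext v; exact mul_smul z w v

theorem circleUnitary_apply (z : Circle) (v : E) : circleUnitary z v = z • v := rfl

/-- The representation `χ ⊗ ρ : (v, h) ↦ χ(v) ρ(h)` of `V ⋊ H_χ`. -/
noncomputable def tensor {H : Subgroup (GLGroup V)} (χ : Character V)
    (ρ : UnitaryRep (χ.stab H) E) : UnitaryRep (SemiProd.sub (χ.stab H)) E where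
  toHom :=
    { toFun := fun g => circleUnitary (χ.eval g.1.1) * ρ ⟨g.1.2, g.2⟩
      map_one' := by
        have h1 : χ.eval ((1 : SemiProd.sub (χ.stab H)) : SemiProd H).1 = 1 := χ.eval_zero
        have h2 : ρ (1 : χ.stab H) = 1 := map_one ρ.toHom
        rw [h1, map_one, one_mul]
        exact h2
      map_mul' := fun a b => by
        have h1 : χ.eval (a * b).1.1 = χ.eval a.1.1 * χ.eval b.1.1 := by
          change χ.eval (a.1.1 + (a.1.2 : GLGroup V).val b.1.1) = _
          rw [eval_add, eval_of_mem_stab a.2]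
        have h2 : ρ ⟨(a * b).1.2, (a * b).2⟩ = ρ ⟨a.1.2, a.2⟩ * ρ ⟨b.1.2, b.2⟩ :=
          map_mul ρ.toHom ⟨a.1.2, a.2⟩ ⟨b.1.2, b.2⟩
        rw [h1, h2]
        ext v
        change (χ.eval a.1.1 * χ.eval b.1.1) • ρ ⟨a.1.2, a.2⟩ (ρ ⟨b.1.2, b.2⟩ v)
          = χ.eval a.1.1 • ρ ⟨a.1.2, a.2⟩ (χ.eval b.1.1 • ρ ⟨b.1.2, b.2⟩ v)
        rw [mul_smul, Circle.smul_def (χ.eval b.1.1) (ρ ⟨b.1.2, b.2⟩ v),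
          (ρ ⟨a.1.2, a.2⟩).map_smul, ← Circle.smul_def] }
  continuous_apply v := by
    have h1 : Continuous fun g : SemiProd.sub (χ.stab H) => χ.eval g.1.1 :=
      χ.continuous_eval.comp ((continuous_fst (X := V) (Y := χ.stab H)).comp
        (SemiProd.subHomeo (χ.stab H)).symm.continuous)
    have h2 : Continuous fun g : SemiProd.sub (χ.stab H) => ρ ⟨g.1.2, g.2⟩ v :=
      (ρ.continuous_apply v).comp ((continuous_snd (X := V) (Y := χ.stab H)).comp
        (SemiProd.subHomeo (χ.stab H)).symm.continuous)
    exact h1.smul h2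

end Character

variable {E : Type*} [NormedAddCommGroup E] [InnerProductSpace ℂ E]

/-- The operator
`∫_V ∫_{H_χ} ψ(v, h⁻¹ h₀ h) (χ · h)(v) ρ(h₀) Δ_H(h₀)^{1/2} Δ_{H_χ}(h₀)^{-1/2} dv dh₀`
on the space of `ρ`. -/
noncomputable def fiberOperator [MeasurableSpace V] {H : Subgroup (GLGroup V)}
    [IsClosed (H : Set (GLGroup V))] (μV : Measure V) (χ : Character V)
    (μχ : Measure (χ.stab H)) (ρ : UnitaryRep (χ.stab H) E) (ψ : SemiProd H → ℂ) (h : H) (w : E) :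
    E :=
  ∫ v : V, ∫ h₀ : χ.stab H,
    (ψ (SemiProd.mk v (h⁻¹ * h₀ * h)) * ((χ.twist h).eval v : ℂ) *
      ((modular (h₀ : H) ^ (1 / 2 : ℝ) * modular h₀ ^ (-(1 / 2) : ℝ) : ℝ) : ℂ)) • ρ h₀ w ∂μχ ∂μV

end Semidirect

end Mackey

/-! Since `ψ = φ ∗ φ*`, the operator `π(ψ)` equals `π(φ) π(φ)*`. It is therefore positive, and its
trace is the squared Hilbert–Schmidt norm of `π(φ)`, that is `∑ ‖π(φ) f_k‖²` over an orthonormal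
basis (`posTrace_integrated_conv`). The `f_k` can be taken to be genuine equivariant functions, so
`π(φ) f_k` is given by an integral at every point `x`, and Tonelli turns the trace into the integral
over `N \ G` of `Φ(x) = ∑ ‖(π(φ) f_k)(x)‖²`. Everything takes place in `[0, ∞]`, so no trace class
assumption and no regularity of an integral kernel is needed.

For fixed `x`, the functional `f ↦ ⟨e, (π(φ) f)(x)⟩` is represented by an explicit vector `k_{x,e}`,
obtained by averaging a translate of `φ` over `N` (`inner_kernelVector`). So `Φ(x)` is the squared
Hilbert–Schmidt norm of evaluation after `π(φ)`, hence also that of its adjoint `e ↦ k_{x,e}`, hence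
the trace of the form `‖k_{x,e}‖²`. Fubini computes this form: up to the factor `Δ_G(x) q(x)` it is
`∫_N ψ(x⁻¹ n x) q(n)^{-1/2} ⟨e, γ(n) e⟩ dn` (`norm_kernelVector_sq`). `exists_trace_density`
collects this for a general closed subgroup `N`.

For `G = V ⋊ H` one has `Δ_G(v, h) = |det h| Δ_H(h)`, and similarly on `N`. The determinants cancel
in `q(n)`, which leaves the half powers of `Δ_H` and `Δ_{H_χ}`; the substitution by `h` in `V`
identifies the form at `(0, h)` with `|det h|` times that of `A(h)` (`inner_fiberOperator`). Finally
`lintegral_transversal_eq` passes from `N \ G` to `H_χ \ H`.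

Integrals over `N \ G` are handled throughout as integrals over `G` against `w q dg`, where `w` is a
weight with all fibre integrals equal to one. This measure is s-finite, so Fubini is available.
Irreducibility enters through the separability of the space of `ρ`, which makes the basis countable.
-/

namespace Mackey

/-! ### Right Haar measures: translation, inversion and the modular function. -/

section RightHaar

variable {G : Type*} [Group G] [TopologicalSpace G] [IsTopologicalGroup G] [LocallyCompactSpace G]

theorem modular_pos (g : G) : 0 < modular g := by
  exact_mod_cast modularCharacterFun_pos g

theorem modular_mul (g h : G) : modular (g * h) = modular g * modular h := by
  simp [modular]

theorem modular_one : modular (1 : G) = 1 := by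
  simp [modular]

theorem modular_inv (g : G) : modular g⁻¹ = (modular g)⁻¹ := by
  refine eq_inv_of_mul_eq_one_left ?_
  rw [← modular_mul, inv_mul_cancel, modular_one]

variable [MeasurableSpace G] [SecondCountableTopology G] [T2Space G] [BorelSpace G]
variable (μ : Measure G) [IsRightHaar μ]

/-- Left translation scales a right Haar measure by the modular function. -/
theorem map_inv_mul_left (a : G) :
    μ.map (fun g => a⁻¹ * g) = ENNReal.ofReal (modular a) • μ := by
  have : IsHaarMeasure μ.inv :=
    { map_mul_left_eq_self := fun g =>
        (inferInstance : IsMulLeftInvariant μ.inv).map_mul_left_eq_self g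
      lt_top_of_isCompact := fun K hK => by
        rw [Measure.inv_apply]; exact hK.inv.measure_lt_top
      open_pos := (continuous_inv.isOpenPosMeasure_map (μ := μ) inv_surjective).open_pos }
  have h1 : μ.inv.map (· * a) = (modularCharacterFun a : ℝ≥0∞) • μ.inv :=
    map_right_mul_eq_modularCharacterFun_smul μ.inv a
  have h2 := congrArg (Measure.map (·⁻¹)) h1
  rw [Measure.map_map (by fun_prop) (by fun_prop), Measure.inv,
    Measure.map_map (by fun_prop) (by fun_prop), Measure.map_smul,
    Measure.map_map (by fun_prop) (by fun_prop)] at h2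
  have e1 : ((fun x : G => x⁻¹) ∘ (fun x => x * a)) ∘ Inv.inv = fun g => a⁻¹ * g := by
    funext g; simp
  have e2 : (fun x : G => x⁻¹) ∘ Inv.inv = id := by funext g; simp
  rw [e1, e2, Measure.map_id] at h2
  rw [h2, modular, ENNReal.ofReal_coe_nnreal]
  rfl

theorem lintegral_inv_mul_left (f : G → ℝ≥0∞) (a : G) :
    ∫⁻ g, f (a⁻¹ * g) ∂μ = ENNReal.ofReal (modular a) * ∫⁻ g, f g ∂μ := by
  have h := lintegral_map_equiv (μ := μ) f (MeasurableEquiv.mulLeft a⁻¹)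
  have h1 : μ.map (MeasurableEquiv.mulLeft a⁻¹) = ENNReal.ofReal (modular a) • μ :=
    map_inv_mul_left μ a
  rw [h1, lintegral_smul_measure, smul_eq_mul] at h
  exact h.symm

theorem lintegral_mul_left (f : G → ℝ≥0∞) (a : G) :
    ∫⁻ g, f (a * g) ∂μ = ENNReal.ofReal (modular a⁻¹) * ∫⁻ g, f g ∂μ := by
  simpa using lintegral_inv_mul_left μ f a⁻¹

theorem integral_mul_left {F : Type*} [NormedAddCommGroup F] [NormedSpace ℝ F]
    (f : G → F) (a : G) :
    ∫ g, f (a * g) ∂μ = modular a⁻¹ • ∫ g, f g ∂μ := by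
  have h := integral_map_equiv (μ := μ) (MeasurableEquiv.mulLeft a) f
  have h1 : μ.map (MeasurableEquiv.mulLeft a) = ENNReal.ofReal (modular a⁻¹) • μ := by
    have := map_inv_mul_left μ a⁻¹
    rwa [inv_inv] at this
  rw [h1, integral_smul_measure, ENNReal.toReal_ofReal (modular_pos _).le] at h
  exact h.symm

/-- For a bump function `f`, `Δ(a)` is the quotient of `∫ f(a⁻¹ g) dg` by the constant `∫ f`, and a
parametric integral depends measurably on `a`. -/
theorem measurable_modular : Measurable (modular : G → ℝ) := by
  borelize G
  let μ : Measure G := (haar : Measure G).inv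
  have : IsRightHaar μ :=
    { map_mul_right_eq_self := fun g =>
        (inferInstance : IsMulRightInvariant μ).map_mul_right_eq_self g
      lt_top_of_isCompact := fun K hK => by
        rw [Measure.inv_apply]; exact hK.inv.measure_lt_top
      open_pos := (continuous_inv.isOpenPosMeasure_map (μ := haar) inv_surjective).open_pos }
  obtain ⟨⟨f, hf⟩, hfc, hf0, hf1⟩ :
    ∃ f : C(G, ℝ), HasCompactSupport f ∧ 0 ≤ f ∧ f 1 ≠ 0 := exists_continuous_nonneg_pos 1
  have hpos : 0 < ∫ g, f g ∂μ :=
    hf.integral_pos_of_hasCompactSupport_nonneg_nonzero hfc hf0 hf1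
  have : (modular : G → ℝ) = fun a => (∫ g, f (a⁻¹ * g) ∂μ) / ∫ g, f g ∂μ := by
    funext a
    rw [integral_inv_mul_left μ f a, mul_div_cancel_right₀ _ hpos.ne']
  rw [this]
  refine Measurable.div_const ?_ _
  have h : StronglyMeasurable fun p : G × G => f (p.1⁻¹ * p.2) := by
    have : Continuous fun p : G × G => f (p.1⁻¹ * p.2) := by fun_prop
    exact this.stronglyMeasurable
  exact h.integral_prod_right.measurable

/-- Inversion of a right Haar measure. -/
theorem lintegral_inv_modular {u : G → ℝ≥0∞} (hu : Measurable u) :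
    ∫⁻ g, u g⁻¹ * ENNReal.ofReal (modular g⁻¹) ∂μ = ∫⁻ g, u g ∂μ := by
  let D : G → ℝ≥0∞ := fun g => ENNReal.ofReal (modular g⁻¹)
  have hD : Measurable D := (measurable_modular.comp measurable_inv).ennreal_ofReal
  have hDm : ∀ g h, D (g * h) = D g * D h := fun g h => by
    simp only [D]
    rw [mul_inv_rev, modular_mul, ENNReal.ofReal_mul (modular_pos _).le, mul_comm]
  have hD0 : ∀ g, D g ≠ 0 := fun g => (ENNReal.ofReal_pos.2 (modular_pos _)).ne'
  have hDt : ∀ g, D g ≠ ∞ := fun g => ENNReal.ofReal_ne_top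
  have hDi : ∀ g, D g⁻¹ * D g = 1 := fun g => by
    rw [← hDm, inv_mul_cancel]
    simp [D, modular_one]
  -- a set of finite positive measure for the density `D`
  have hσ : SigmaFinite (μ.withDensity D) := by
    apply SigmaFinite.withDensity_of_ne_top
    exact Filter.Eventually.of_forall hDt
  have hne : (μ.withDensity D) Set.univ ≠ 0 := by
    rw [withDensity_apply _ MeasurableSet.univ, Measure.restrict_univ]
    intro h0
    rw [lintegral_eq_zero_iff hD] at h0
    have h1 : μ Set.univ = 0 := by
      refine measure_mono_null (fun g _ => ?_) h0
      exact hD0 g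
    exact (isOpen_univ.measure_pos μ ⟨1, trivial⟩).ne' h1
  obtain ⟨S, hSm, -, hS0, hSt⟩ := exists_subset_measure_lt_top (μ := μ.withDensity D)
    MeasurableSet.univ (pos_iff_ne_zero.2 hne)
  let F : G → ℝ≥0∞ := S.indicator 1
  have hF : Measurable F := measurable_one.indicator hSm
  have hIF : ∫⁻ g, F g * D g ∂μ = (μ.withDensity D) S := by
    rw [withDensity_apply _ hSm, ← lintegral_indicator hSm]
    refine lintegral_congr fun g => ?_
    by_cases hg : g ∈ S <;> simp [F, hg]
  -- The double integral of `u(y) F(xy) D(xy)` is evaluated in both orders. Integrating first in `x`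
  -- uses right invariance; in the other order the left translations `y ↦ x⁻¹ y` and `x ↦ y⁻¹ x`
  -- produce the inverted argument. The common factor `∫ F D` is finite and nonzero, so it cancels.
  have key : (∫⁻ g, F g * D g ∂μ) * ∫⁻ y, u y ∂μ
      = (∫⁻ g, F g * D g ∂μ) * ∫⁻ g, u g⁻¹ * D g ∂μ := by
    calc (∫⁻ g, F g * D g ∂μ) * ∫⁻ y, u y ∂μ
        = ∫⁻ y, ∫⁻ x, u y * (F (x * y) * D (x * y)) ∂μ ∂μ := by
          rw [← lintegral_const_mul _ hu]
          refine lintegral_congr fun y => ?_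
          rw [lintegral_const_mul _ (by fun_prop),
            lintegral_mul_right_eq_self (μ := μ) (fun x => F x * D x) y, mul_comm]
      _ = ∫⁻ x, ∫⁻ y, u y * (F (x * y) * D (x * y)) ∂μ ∂μ :=
          lintegral_lintegral_swap (by fun_prop)
      _ = ∫⁻ x, ∫⁻ y, D x * (u (x⁻¹ * y) * (F y * D y)) ∂μ ∂μ := by
          refine lintegral_congr fun x => ?_
          have := lintegral_mul_left μ (fun y => u (x⁻¹ * y) * (F y * D y)) x
          simp only [inv_mul_cancel_left] at this
          rw [this, lintegral_const_mul _ (by fun_prop)]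
      _ = ∫⁻ y, ∫⁻ x, D x * (u (x⁻¹ * y) * (F y * D y)) ∂μ ∂μ :=
          lintegral_lintegral_swap (by fun_prop)
      _ = ∫⁻ y, (F y * D y) * ∫⁻ g, u g⁻¹ * D g ∂μ ∂μ := by
          refine lintegral_congr fun y => ?_
          have := lintegral_inv_mul_left μ (fun g => u g⁻¹ * D g) y
          simp only [mul_inv_rev, inv_inv, hDm] at this
          -- Splitting `D x = D y · D(y⁻¹ x)` exhibits a left translate by `y⁻¹`; the remaining `D
          -- y` cancels the factor `Δ(y)` created by that translation.
          have e : ∀ x, D x * (u (x⁻¹ * y) * (F y * D y))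
              = (F y * D y) * (D y * (u (x⁻¹ * y) * (D y⁻¹ * D x))) := fun x => by
            calc _ = (D y⁻¹ * D y) * (D x * (u (x⁻¹ * y) * (F y * D y))) := by
                  rw [hDi, one_mul]
              _ = _ := by ring
          simp_rw [e]
          rw [lintegral_const_mul _ (by fun_prop), lintegral_const_mul _ (by fun_prop), this,
            ← mul_assoc (D y)]
          have h1 : D y * ENNReal.ofReal (modular y) = 1 := by
            have := hDi y
            simp only [D, inv_inv] at this ⊢
            rw [mul_comm]; exact this
          rw [h1, one_mul]
      _ = (∫⁻ g, F g * D g ∂μ) * ∫⁻ g, u g⁻¹ * D g ∂μ :=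
          lintegral_mul_const _ (by fun_prop)
  rw [hIF] at key
  exact ((ENNReal.mul_right_inj hS0.ne' hSt.ne).1 key).symm

/-- As an identity of measures, the inversion rule transfers at once to Bochner integrals and to
integrability. -/
theorem map_inv_withDensity_modular :
    (μ.withDensity fun g => ENNReal.ofReal (modular g⁻¹)).map (·⁻¹) = μ := by
  have hD : Measurable fun g : G => ENNReal.ofReal (modular g⁻¹) :=
    (measurable_modular.comp measurable_inv).ennreal_ofReal
  ext s hs
  rw [← lintegral_indicator_one hs, lintegral_map (measurable_one.indicator hs) (by fun_prop),
    lintegral_withDensity_eq_lintegral_mul _ hD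
      (g := fun g => s.indicator 1 g⁻¹) ((measurable_one.indicator hs).comp measurable_inv),
    ← lintegral_indicator_one hs, ← lintegral_inv_modular μ (measurable_one.indicator hs)]
  exact lintegral_congr fun g => mul_comm _ _

theorem integral_inv_modular {F : Type*} [NormedAddCommGroup F] [NormedSpace ℝ F] (u : G → F) :
    ∫ g, modular g⁻¹ • u g⁻¹ ∂μ = ∫ g, u g ∂μ := by
  have hD : Measurable fun g : G => modular g⁻¹ := measurable_modular.comp measurable_inv
  conv_rhs => rw [← map_inv_withDensity_modular μ]
  have h := integral_map_equiv (μ := μ.withDensity fun g => ENNReal.ofReal (modular g⁻¹))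
    (MeasurableEquiv.inv G) u
  refine Eq.trans ?_ h.symm
  have h2 := integral_withDensity_eq_integral_smul (μ := μ)
    (f := fun g : G => (modular g⁻¹).toNNReal) hD.real_toNNReal
    (fun g => u (MeasurableEquiv.inv G g))
  refine Eq.trans ?_ h2.symm
  refine integral_congr_ae (Filter.Eventually.of_forall fun g => ?_)
  simp only [NNReal.smul_def, Real.coe_toNNReal _ (modular_pos g⁻¹).le]
  rfl

theorem integrable_involution {φ : G → ℂ} (hφ : Integrable φ μ) :
    Integrable (involution φ) μ := by
  have h := hφ
  rw [← map_inv_withDensity_modular μ] at h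
  have hD : Measurable fun g : G => modular g⁻¹ := measurable_modular.comp measurable_inv
  have h1 := (integrable_map_equiv (MeasurableEquiv.inv G) φ).1 h
  have h2 := (integrable_withDensity_iff_integrable_smul (μ := μ)
    (f := fun g : G => (modular g⁻¹).toNNReal) hD.real_toNNReal).1 h1
  have h3 := Complex.conjCLE.toContinuousLinearMap.integrable_comp h2
  refine h3.congr (Filter.Eventually.of_forall fun g => ?_)
  simp only [NNReal.smul_def, Real.coe_toNNReal _ (modular_pos g⁻¹).le]
  change (starRingEnd ℂ) ((modular g⁻¹ : ℝ) • φ g⁻¹) = _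
  rw [Complex.real_smul, map_mul, Complex.conj_ofReal, mul_comm]
  rfl

end RightHaar

/-! ### The function `φ ∗ φ*`. -/

section Convolution

variable {G : Type*} [Group G] [TopologicalSpace G] [IsTopologicalGroup G] [LocallyCompactSpace G]
variable [MeasurableSpace G] [SecondCountableTopology G] [T2Space G] [BorelSpace G]
variable (μ : Measure G) [IsRightHaar μ]

/-- The substitution `y ↦ y⁻¹` absorbs the modular factor of `φ*`. The resulting formula makes both
continuity and the support visible. -/
theorem conv_involution_apply (φ : G → ℂ) (x : G) :
    conv μ φ (involution φ) x = ∫ y, φ (x * y) * (starRingEnd ℂ) (φ y) ∂μ := by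
  rw [← integral_inv_modular μ, conv]
  refine integral_congr_ae (Filter.Eventually.of_forall fun y => ?_)
  simp only [involution, Complex.real_smul]
  ring

/-- The factor `conj φ(y)` confines the integration to a compact set independent of `x`. -/
theorem continuous_conv_involution {φ : G → ℂ} (hφ : Continuous φ) (hc : HasCompactSupport φ) :
    Continuous (conv μ φ (involution φ)) := by
  have h : conv μ φ (involution φ)
      = fun x => ∫ y in tsupport φ, φ (x * y) * (starRingEnd ℂ) (φ y) ∂μ := by
    funext x
    rw [conv_involution_apply, setIntegral_eq_integral_of_forall_compl_eq_zero]
    intro y hy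
    rw [image_eq_zero_of_notMem_tsupport hy, map_zero, mul_zero]
  rw [h]
  refine continuous_parametric_integral_of_continuous ?_ hc
  have : Continuous fun p : G × G => φ (p.1 * p.2) * (starRingEnd ℂ) (φ p.2) := by fun_prop
  exact this

theorem hasCompactSupport_conv_involution {φ : G → ℂ} (hc : HasCompactSupport φ) :
    HasCompactSupport (conv μ φ (involution φ)) := by
  refine HasCompactSupport.intro (K := tsupport φ * (tsupport φ)⁻¹)
    (hc.isCompact.mul hc.isCompact.inv) fun x hx => ?_
  rw [conv_involution_apply]
  refine integral_eq_zero_of_ae (Filter.Eventually.of_forall fun y => ?_)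
  by_cases h1 : x * y ∈ tsupport φ
  · by_cases h2 : y ∈ tsupport φ
    · exact absurd ⟨x * y, h1, y⁻¹, Set.inv_mem_inv.2 h2, by simp⟩ hx
    · simp [image_eq_zero_of_notMem_tsupport h2]
  · simp [image_eq_zero_of_notMem_tsupport h1]

end Convolution

/-! ### Traces, Hilbert–Schmidt norms and countable bases. -/

section Hilbert

variable {E : Type*} [NormedAddCommGroup E] [InnerProductSpace ℂ E] [CompleteSpace E]
variable {F : Type*} [NormedAddCommGroup F] [InnerProductSpace ℂ F] [CompleteSpace F]

/-- Parseval's identity. -/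
theorem tsum_enorm_inner_sq {ι : Type*} (b : HilbertBasis ι ℂ E) (v : E) :
    ∑' i, ‖inner ℂ (b i) v‖ₑ ^ 2 = ‖v‖ₑ ^ 2 := by
  have h := (b.hasSum_inner_mul_inner v v).mapL Complex.reCLM
  have h1 : ∀ i, Complex.reCLM (inner ℂ v (b i) * inner ℂ (b i) v) = ‖inner ℂ (b i) v‖ ^ 2 := by
    intro i
    rw [← inner_conj_symm v (b i), mul_comm, Complex.mul_conj, Complex.normSq_eq_norm_sq]
    exact Complex.ofReal_re _
  have h2 : Complex.reCLM (inner ℂ v v) = ‖v‖ ^ 2 := by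
    rw [inner_self_eq_norm_sq_to_K]
    norm_cast
  simp only [h1, h2] at h
  have h3 : ∀ w : ℝ, 0 ≤ w → ENNReal.ofReal (w ^ 2) = ENNReal.ofReal w ^ 2 :=
    fun w hw => ENNReal.ofReal_pow hw 2
  rw [← ofReal_norm, ← h3 _ (norm_nonneg _), ← h.tsum_eq,
    ENNReal.ofReal_tsum_of_nonneg (fun i => sq_nonneg _) h.summable]
  refine tsum_congr fun i => ?_
  rw [h3 _ (norm_nonneg _), ofReal_norm]

/-- The Hilbert–Schmidt norms of an operator and of its adjoint agree. -/
theorem tsum_enorm_sq_swap {ι κ : Type*} (b : HilbertBasis ι ℂ E) (c : HilbertBasis κ ℂ F)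
    {S : ι → F} {R : κ → E} (h : ∀ i k, inner ℂ (S i) (c k) = inner ℂ (b i) (R k)) :
    ∑' i, ‖S i‖ₑ ^ 2 = ∑' k, ‖R k‖ₑ ^ 2 := by
  simp_rw [← tsum_enorm_inner_sq c (S _), ← tsum_enorm_inner_sq b (R _)]
  rw [ENNReal.tsum_comm]
  refine tsum_congr fun k => tsum_congr fun i => ?_
  rw [← h i k, ← inner_conj_symm (c k) (S i), ← ofReal_norm, ← ofReal_norm, RCLike.norm_conj]

/-- The trace of `S* S` is the squared Hilbert–Schmidt norm of `S*`. -/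
theorem posTrace_eq_tsum {κ : Type*} (c : HilbertBasis κ ℂ F) {T : E → E} {S : E → F} {R : κ → E}
    (hT : ∀ v, (inner ℂ v (T v)).re = ‖S v‖ ^ 2)
    (h : ∀ v k, inner ℂ (S v) (c k) = inner ℂ v (R k)) :
    posTrace T = ∑' k, ‖R k‖ₑ ^ 2 := by
  obtain ⟨b, hb⟩ := (exists_hilbertBasis ℂ E).choose_spec
  rw [posTrace, ← tsum_enorm_sq_swap b c (S := fun i => S (b i)) fun i k => h (b i) k]
  refine tsum_congr fun i => ?_
  rw [hT, hb, ENNReal.ofReal_pow (norm_nonneg _), ofReal_norm]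

/-- A separable pre-Hilbert space contains an orthonormal basis of its completion. -/
theorem exists_hilbertBasis_completion (P : Type*) [SeminormedAddCommGroup P]
    [InnerProductSpace ℂ P] [TopologicalSpace.SeparableSpace P] :
    ∃ (κ : Set ℕ) (f : κ → P) (c : HilbertBasis κ ℂ (UniformSpace.Completion P)),
      ∀ k, c k = (f k : UniformSpace.Completion P) := by
  let d : ℕ → UniformSpace.Completion P := fun n => (TopologicalSpace.denseSeq P n : P)
  have hd : DenseRange d := UniformSpace.Completion.denseRange_coe.comp
    (TopologicalSpace.denseRange_denseSeq P) (UniformSpace.Completion.continuous_coe P)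
  let c₀ := InnerProductSpace.gramSchmidtNormed ℂ d
  -- Gram–Schmidt returns zero at an index whose vector depends linearly on its predecessors;
  -- dropping these leaves an orthonormal family with the same span.
  let κ : Set ℕ := {n | c₀ n ≠ 0}
  have horth : Orthonormal ℂ fun n : κ => c₀ n :=
    InnerProductSpace.gramSchmidtNormed_orthonormal' d
  have hspan : Submodule.span ℂ (Set.range fun n : κ => c₀ n)
      = Submodule.span ℂ (Set.range d) := by
    rw [← InnerProductSpace.span_gramSchmidt ℂ d,
      ← InnerProductSpace.span_gramSchmidtNormed_range]
    refine le_antisymm (Submodule.span_mono ?_) (Submodule.span_le.2 ?_)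
    · rintro _ ⟨n, rfl⟩
      exact ⟨n, rfl⟩
    · rintro _ ⟨n, rfl⟩
      by_cases hn : c₀ n = 0
      · change c₀ n ∈ _
        rw [hn]
        exact Submodule.zero_mem _
      · exact Submodule.subset_span ⟨⟨n, hn⟩, rfl⟩
  have htop : ⊤ ≤ (Submodule.span ℂ (Set.range fun n : κ => c₀ n)).topologicalClosure := by
    rw [hspan]
    intro x _
    exact closure_mono Submodule.subset_span (hd x)
  -- Gram–Schmidt vectors are finite linear combinations of the `d k`, so they come from `P` and not
  -- merely from its completion. This is what later gives basis vectors that are actual functions on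
  -- the group.
  have hmem : ∀ n, ∃ f : P, (f : UniformSpace.Completion P) = c₀ n := by
    intro n
    have h1 : c₀ n ∈ Submodule.span ℂ (Set.range d) := by
      rw [← InnerProductSpace.span_gramSchmidt ℂ d,
        ← InnerProductSpace.span_gramSchmidtNormed_range]
      exact Submodule.subset_span ⟨n, rfl⟩
    have h2 : Submodule.span ℂ (Set.range d)
        ≤ LinearMap.range (UniformSpace.Completion.toComplₗᵢ (𝕜 := ℂ) (E := P)).toLinearMap := by
      rw [Submodule.span_le]
      rintro _ ⟨k, rfl⟩
      exact ⟨_, rfl⟩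
    exact h2 h1
  choose f hf using hmem
  refine ⟨κ, fun k => f k, HilbertBasis.mk horth htop, fun k => ?_⟩
  rw [HilbertBasis.coe_mk, hf]

/-- Weak measurability implies strong measurability in the presence of a countable basis. -/
theorem stronglyMeasurable_of_inner {α κ : Type*} [MeasurableSpace α] [Countable κ]
    (c : HilbertBasis κ ℂ F) {f : α → F}
    (hf : ∀ k, StronglyMeasurable fun a => inner ℂ (c k) (f a)) : StronglyMeasurable f := by
  refine stronglyMeasurable_of_tendsto (Filter.atTop : Filter (Finset κ))
    (f := fun s a => ∑ k ∈ s, (inner ℂ (c k) (f a) : ℂ) • c k) (fun s => ?_) ?_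
  · exact Finset.stronglyMeasurable_fun_sum s fun k _ => (hf k).smul_const (c k)
  · rw [tendsto_pi_nhds]
    intro a
    have h := c.hasSum_repr (f a)
    simp only [c.repr_apply_apply] at h
    exact h

end Hilbert

/-! ### Integrated operators and the positivity of `π(φ ∗ φ*)`. -/

section Integrated

variable {G : Type*} [Group G] [TopologicalSpace G]
variable {E : Type*} [NormedAddCommGroup E] [InnerProductSpace ℂ E]

/-- The space of an irreducible representation of a second countable group is separable. -/
theorem UnitaryRep.IsIrreducible.separableSpace [SecondCountableTopology G] {ρ : UnitaryRep G E}
    (hρ : ρ.IsIrreducible) : TopologicalSpace.SeparableSpace E := by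
  obtain ⟨hn, hirr⟩ := hρ
  obtain ⟨v, hv⟩ := exists_ne (0 : E)
  -- The closed span of one nonzero orbit is invariant, hence the whole space; the orbit is a
  -- continuous image of a second countable group, so its closed span is separable.
  let W : Submodule ℂ E := Submodule.span ℂ (Set.range fun g => ρ g v)
  have hW : ∀ g, ∀ w ∈ W.topologicalClosure, ρ g w ∈ W.topologicalClosure := by
    intro g
    have h1 : W ≤ W.comap (ρ g).toLinearEquiv.toLinearMap := by
      rw [Submodule.span_le]
      rintro _ ⟨k, rfl⟩
      refine Submodule.subset_span ⟨g * k, ?_⟩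
      change ρ.toHom (g * k) v = ρ.toHom g (ρ.toHom k v)
      rw [map_mul]
      rfl
    intro w hw
    exact map_mem_closure (ρ g).continuous hw fun a ha => h1 ha
  have hsep : TopologicalSpace.IsSeparable (W.topologicalClosure : Set E) := by
    refine TopologicalSpace.IsSeparable.closure (TopologicalSpace.IsSeparable.span ?_)
    exact TopologicalSpace.isSeparable_range (ρ.continuous_apply v)
  rcases hirr W.topologicalClosure W.isClosed_topologicalClosure hW with h | h
  · have h1 : v ∈ W.topologicalClosure := by
      refine W.le_topologicalClosure (Submodule.subset_span ⟨1, ?_⟩)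
      change ρ.toHom 1 v = v
      rw [map_one]
      rfl
    rw [h] at h1
    exact absurd ((Submodule.mem_bot ℂ).1 h1) hv
  · rw [h] at hsep
    exact TopologicalSpace.isSeparable_univ_iff.1 hsep

variable [IsTopologicalGroup G] [LocallyCompactSpace G]
variable [MeasurableSpace G] [SecondCountableTopology G] [T2Space G] [BorelSpace G]
variable (μ : Measure G) [IsRightHaar μ] [CompleteSpace E]
variable {π : G →* (E ≃ₗᵢ[ℂ] E)}

theorem integrable_smul_rep (hπ : ∀ v, StronglyMeasurable fun g => π g v) {φ : G → ℂ}
    (hφ : Integrable φ μ) (v : E) : Integrable (fun g => φ g • π g v) μ := by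
  refine (hφ.norm.mul_const ‖v‖).mono' (hφ.1.smul (hπ v).aestronglyMeasurable) ?_
  exact Filter.Eventually.of_forall fun g => by simp [norm_smul]

theorem inner_integrated (hπ : ∀ v, StronglyMeasurable fun g => π g v) {φ : G → ℂ}
    (hφ : Integrable φ μ) (u v : E) :
    inner ℂ u (integrated μ π φ v) = ∫ g, φ g * inner ℂ u (π g v) ∂μ := by
  rw [integrated, ← integral_inner (integrable_smul_rep μ hπ hφ v)]
  simp_rw [inner_smul_right]

/-- `π(φ*)` is the adjoint of `π(φ)`. -/
theorem inner_integrated_involution (hπ : ∀ v, StronglyMeasurable fun g => π g v) {φ : G → ℂ}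
    (hφ : Integrable φ μ) (u v : E) :
    inner ℂ u (integrated μ π (involution φ) v) = inner ℂ (integrated μ π φ u) v := by
  rw [inner_integrated μ hπ (integrable_involution μ hφ), ← inner_conj_symm,
    inner_integrated μ hπ hφ, ← integral_conj]
  refine Eq.trans ?_ (integral_inv_modular μ _)
  refine integral_congr_ae (Filter.Eventually.of_forall fun g => ?_)
  have h : inner ℂ (π g⁻¹ u) v = inner ℂ u (π g v) := by
    rw [← (π g).inner_map_map (π g⁻¹ u) v]
    congr 1
    rw [map_inv]
    exact (π g).apply_symm_apply u
  simp only [involution, map_mul, inner_conj_symm, Complex.real_smul, h]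
  ring

/-- By right invariance the inner `L¹` norm in the first variable does not depend on `y`, so the
double norm is the product of the two `L¹` norms. -/
theorem integrable_conv {f₁ f₂ : G → ℂ} (h₁ : Integrable f₁ μ) (hm₁ : StronglyMeasurable f₁)
    (h₂ : Integrable f₂ μ) :
    Integrable (fun p : G × G => f₁ (p.1 * p.2⁻¹) * f₂ p.2) (μ.prod μ) := by
  refine (integrable_prod_iff' ?_).2 ⟨Filter.Eventually.of_forall fun y => ?_, ?_⟩
  · exact (hm₁.comp_measurable (by fun_prop)).aestronglyMeasurable.mul h₂.1.comp_snd
  · exact (h₁.comp_mul_right y⁻¹).mul_const (f₂ y)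
  · simp_rw [norm_mul, integral_mul_const]
    have : ∀ y : G, ∫ x, ‖f₁ (x * y⁻¹)‖ ∂μ = ∫ x, ‖f₁ x‖ ∂μ := fun y =>
      integral_mul_right_eq_self (fun x => ‖f₁ x‖) y⁻¹
    simp_rw [this]
    exact h₂.norm.const_mul _

/-- This is `π(φ ∗ φ*) = π(φ) π(φ*)` tested on the diagonal: after Fubini, the substitution `x ↦ x
y` splits `π(x y)`, and the outer `π(φ)` moves to the other slot as `π(φ*)`. -/
theorem inner_integrated_conv (hπ : ∀ v, StronglyMeasurable fun g => π g v) {φ : G → ℂ}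
    (hφ : Integrable φ μ) (hm : StronglyMeasurable φ) (v : E) :
    inner ℂ v (integrated μ π (conv μ φ (involution φ)) v)
      = (‖integrated μ π (involution φ) v‖ ^ 2 : ℝ) := by
  have hI := integrable_conv μ hφ hm (integrable_involution μ hφ)
  have hw : StronglyMeasurable fun g => inner ℂ v (π g v) :=
    (stronglyMeasurable_const).inner (hπ v)
  have hI2 : Integrable (fun p : G × G => φ (p.1 * p.2⁻¹) * involution φ p.2 *
      inner ℂ v (π p.1 v)) (μ.prod μ) := by
    refine hI.mul_bdd (c := ‖v‖ * ‖v‖) ?_ ?_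
    · exact (hw.comp_measurable measurable_fst).aestronglyMeasurable
    · refine Filter.Eventually.of_forall fun p => (norm_inner_le_norm _ _).trans ?_
      rw [LinearIsometryEquiv.norm_map]
  have hconv : Integrable (conv μ φ (involution φ)) μ := hI.integral_prod_left
  rw [inner_integrated μ hπ hconv]
  calc ∫ x, conv μ φ (involution φ) x * inner ℂ v (π x v) ∂μ
      = ∫ x, ∫ y, φ (x * y⁻¹) * involution φ y * inner ℂ v (π x v) ∂μ ∂μ := by
        simp_rw [conv, integral_mul_const]
    _ = ∫ y, ∫ x, φ (x * y⁻¹) * involution φ y * inner ℂ v (π x v) ∂μ ∂μ :=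
        integral_integral_swap hI2
    _ = ∫ y, involution φ y * inner ℂ (integrated μ π (involution φ) v) (π y v) ∂μ := by
        refine integral_congr_ae (Filter.Eventually.of_forall fun y => ?_)
        have h1 := integral_mul_right_eq_self (μ := μ)
          (fun x => φ (x * y⁻¹) * involution φ y * inner ℂ v (π x v)) y
        simp only [mul_inv_cancel_right] at h1
        have h2 : inner ℂ (integrated μ π (involution φ) v) (π y v)
            = inner ℂ v (integrated μ π φ (π y v)) := by
          rw [← inner_conj_symm, inner_integrated_involution μ hπ hφ, inner_conj_symm]
        beta_reduce
        rw [← h1, h2, inner_integrated μ hπ hφ, ← integral_const_mul]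
        refine integral_congr_ae (Filter.Eventually.of_forall fun x => ?_)
        beta_reduce
        rw [map_mul]
        change _ * inner ℂ v (π x (π y v)) = _
        ring
    _ = inner ℂ (integrated μ π (involution φ) v) (integrated μ π (involution φ) v) :=
        (inner_integrated μ hπ (integrable_involution μ hφ) _ _).symm
    _ = _ := by rw [inner_self_eq_norm_sq_to_K]; norm_cast

/-- The positive form is the squared norm of `π(φ*) v`; exchanging `π(φ*)` for its adjoint `π(φ)`
also frees the choice of basis. -/
theorem posTrace_integrated_conv (hπ : ∀ v, StronglyMeasurable fun g => π g v) {φ : G → ℂ}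
    (hφ : Integrable φ μ) (hm : StronglyMeasurable φ) {κ : Type*} (c : HilbertBasis κ ℂ E) :
    posTrace (integrated μ π (conv μ φ (involution φ)))
      = ∑' k, ‖integrated μ π φ (c k)‖ₑ ^ 2 := by
  refine posTrace_eq_tsum c (S := integrated μ π (involution φ)) (fun v => ?_) fun v k => ?_
  · rw [inner_integrated_conv μ hπ hφ hm]
    exact Complex.ofReal_re _
  · rw [← inner_conj_symm, inner_integrated_involution μ hπ hφ, inner_conj_symm]

theorem isPositiveOp_integrated_conv (hπ : ∀ v, StronglyMeasurable fun g => π g v) {φ : G → ℂ}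
    (hφ : Integrable φ μ) (hm : StronglyMeasurable φ) :
    IsPositiveOp (integrated μ π (conv μ φ (involution φ))) := by
  intro v
  rw [inner_integrated_conv μ hπ hφ hm, Complex.ofReal_re, Complex.ofReal_im]
  exact ⟨sq_nonneg _, rfl⟩

end Integrated

/-! ### Integration over `N \ G` by a weighted measure on `G`. -/

section Transversal

variable {G : Type*} [Group G] [TopologicalSpace G] [IsTopologicalGroup G] [LocallyCompactSpace G]
variable [MeasurableSpace G] [SecondCountableTopology G] [T2Space G] [BorelSpace G]
variable {N : Subgroup G} [IsClosed (N : Set G)]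

/-- A measure on `G` whose image on `N \ G` is `d_q`. -/
noncomputable def transversal (μG : Measure G) (μN : Measure N) [IsRightHaar μN] (q : G → ℝ) :
    Measure G :=
  μG.withDensity fun g => (exists_bruhat (N := N) μN).choose g * ENNReal.ofReal (q g)

variable {μG : Measure G} [IsRightHaar μG] {μN : Measure N} [IsRightHaar μN]
variable {q : G → ℝ} {ν : Measure (RightCosets N)}

/-- This is what makes Tonelli and Fubini applicable to quotient integrals, without any finiteness
property of `ν` itself. -/
instance : SFinite (transversal μG μN q) := by
  unfold transversal
  infer_instance

theorem lintegral_transversal (hq : IsRhoFunction N q) {F : G → ℝ≥0∞} (hF : Measurable F) :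
    ∫⁻ g, F g ∂(transversal μG μN q)
      = ∫⁻ g, (exists_bruhat (N := N) μN).choose g * F g * ENNReal.ofReal (q g) ∂μG := by
  have hqm : Measurable fun g => ENNReal.ofReal (q g) := hq.continuous.measurable.ennreal_ofReal
  have hw : Measurable fun g => (exists_bruhat (N := N) μN).choose g * ENNReal.ofReal (q g) :=
    (exists_bruhat (N := N) μN).choose_spec.1.mul hqm
  rw [transversal, lintegral_withDensity_eq_lintegral_mul _ hw hF]
  refine lintegral_congr fun g => ?_
  simp only [Pi.mul_apply]
  ring

/-- Integrals over `N \ G` as integrals over `G`. -/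
theorem lintegral_out (hq : IsRhoFunction N q) (hν : IsQuotientMeasure N μG μN q ν)
    {F : G → ℝ≥0∞} (hF : Measurable F) (hFN : ∀ (n : N) (g : G), F (n * g) = F g) :
    ∫⁻ x : RightCosets N, F x.out ∂ν = ∫⁻ g, F g ∂(transversal μG μN q) := by
  obtain ⟨hw, hw1⟩ := (exists_bruhat (N := N) μN).choose_spec
  rw [lintegral_transversal hq hF,
    ← hν.lintegral_eq hq (F := fun g => (exists_bruhat (N := N) μN).choose g * F g) (hw.mul hF)]
  refine lintegral_congr fun x => ?_
  simp only [hFN]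
  rw [lintegral_mul_const _ (by fun_prop), hw1, one_mul]

theorem measurable_coset : Measurable (coset N) :=
  measurable_quotient_mk'' (s := QuotientGroup.rightRel N)

theorem map_coset_transversal (hq : IsRhoFunction N q) (hν : IsQuotientMeasure N μG μN q ν) :
    (transversal μG μN q).map (coset N) = ν := by
  have hout : ∀ x : RightCosets N, coset N x.out = x := fun x => Quotient.out_eq x
  ext s hs
  have hm : Measurable fun g : G => s.indicator (1 : RightCosets N → ℝ≥0∞) (coset N g) :=
    (measurable_one.indicator hs).comp measurable_coset
  rw [← lintegral_indicator_one hs, ← lintegral_indicator_one hs,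
    lintegral_map (measurable_one.indicator hs) measurable_coset, ← lintegral_out hq hν hm]
  · simp_rw [hout]
  · intro n g
    have : coset N (n * g) = coset N g := by
      refine Quotient.sound ?_
      change (QuotientGroup.rightRel N) _ _
      rw [QuotientGroup.rightRel_apply]
      simp
    rw [this]

theorem integral_out (hq : IsRhoFunction N q) (hν : IsQuotientMeasure N μG μN q ν)
    {F : G → ℂ} (hF : Measurable F) (hFN : ∀ (n : N) (g : G), F (n * g) = F g) :
    ∫ x : RightCosets N, F x.out ∂ν = ∫ g, F g ∂(transversal μG μN q) := by
  rw [← map_coset_transversal hq hν, integral_map measurable_coset.aemeasurable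
    (measurable_out hFN hF).aestronglyMeasurable]
  exact integral_congr_ae (Filter.Eventually.of_forall fun g => apply_out_coset hFN g)

theorem lintegral_lintegral_fiber (hq : IsRhoFunction N q) (hν : IsQuotientMeasure N μG μN q ν)
    {F : G → ℝ≥0∞} (hF : Measurable F) :
    ∫⁻ g, ∫⁻ n : N, F (n * g) ∂μN ∂(transversal μG μN q)
      = ∫⁻ g, F g * ENNReal.ofReal (q g) ∂μG := by
  rw [← hν.lintegral_eq hq hF]
  exact (lintegral_out hq hν (measurable_fiber μN hF) fun n g => fiber_invariant μN F n g).symm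

/-- The fibration formula as an identity of measures: integrability on `G` transports to the
product, where the ordinary Fubini theorem applies to complex functions. -/
theorem map_mul_transversal_prod (hq : IsRhoFunction N q) (hν : IsQuotientMeasure N μG μN q ν) :
    ((transversal μG μN q).prod μN).map (fun p => (p.2 : G) * p.1)
      = μG.withDensity fun g => ENNReal.ofReal (q g) := by
  have hqm : Measurable fun g => ENNReal.ofReal (q g) := hq.continuous.measurable.ennreal_ofReal
  have hmul : Measurable fun p : G × N => (p.2 : G) * p.1 := by fun_prop
  ext s hs
  have h1 : Measurable (s.indicator (1 : G → ℝ≥0∞)) := measurable_one.indicator hs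
  rw [← lintegral_indicator_one hs, ← lintegral_indicator_one hs, lintegral_map h1 hmul,
    lintegral_prod (fun p : G × N => s.indicator 1 ((p.2 : G) * p.1)) (h1.comp hmul).aemeasurable,
    lintegral_withDensity_eq_lintegral_mul _ hqm h1]
  refine (lintegral_lintegral_fiber hq hν h1).trans (lintegral_congr fun g => ?_)
  exact mul_comm _ _

/-- Fubini for the fibration `G → N \ G`. -/
theorem integral_integral_fiber (hq : IsRhoFunction N q) (hν : IsQuotientMeasure N μG μN q ν)
    {F : G → ℂ} (hF : StronglyMeasurable F) (hi : Integrable (fun g => (q g : ℂ) * F g) μG) :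
    ∫ g, ∫ n : N, F (n * g) ∂μN ∂(transversal μG μN q) = ∫ g, (q g : ℂ) * F g ∂μG := by
  have hqm : Measurable fun g => (q g).toNNReal := hq.continuous.measurable.real_toNNReal
  have hmul : Measurable fun p : G × N => (p.2 : G) * p.1 := by fun_prop
  have he : (fun g => ((q g).toNNReal : ℝ≥0) • F g) = fun g => (q g : ℂ) * F g := by
    funext g
    rw [NNReal.smul_def, Real.coe_toNNReal _ (hq.pos g).le, Complex.real_smul]
  have hwd : Integrable F (μG.withDensity fun g => ENNReal.ofReal (q g)) := by
    refine (integrable_withDensity_iff_integrable_smul (f := fun g => (q g).toNNReal) hqm).2 ?_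
    rw [he]
    exact hi
  rw [← he]
  have h1 := integral_withDensity_eq_integral_smul (μ := μG) (f := fun g => (q g).toNNReal) hqm F
  refine Eq.trans ?_ h1
  change _ = ∫ g, F g ∂(μG.withDensity fun g => ENNReal.ofReal (q g))
  rw [← map_mul_transversal_prod hq hν] at hwd ⊢
  rw [integral_map hmul.aemeasurable hF.aestronglyMeasurable, integral_prod]
  exact (integrable_map_measure hF.aestronglyMeasurable hmul.aemeasurable).1 hwd

end Transversal

/-! ### Separability and measurability for the induced representation. -/

section IndPre

variable {G : Type*} [Group G] [TopologicalSpace G] [IsTopologicalGroup G] [LocallyCompactSpace G]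
variable [MeasurableSpace G] [SecondCountableTopology G] [T2Space G] [BorelSpace G]
variable {N : Subgroup G} [IsClosed (N : Set G)]
variable {E : Type*} [NormedAddCommGroup E] [InnerProductSpace ℂ E]
variable {μG : Measure G} [IsRightHaar μG] {μN : Measure N} [IsRightHaar μN]
variable {q : G → ℝ} {ν : Measure (RightCosets N)} {γ : UnitaryRep N E}

namespace IndPre

theorem stronglyMeasurable (f : IndPre γ ν) : StronglyMeasurable (f : G → E) := f.2.1

theorem enorm_sq_eq_transversal (hq : IsRhoFunction N q) (hν : IsQuotientMeasure N μG μN q ν)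
    (f : IndPre γ ν) : ‖f‖ₑ ^ 2 = ∫⁻ g, ‖f g‖ₑ ^ 2 ∂(transversal μG μN q) := by
  rw [enorm_sq_eq]
  exact lintegral_out hq hν (F := fun g => ‖f g‖ₑ ^ 2) (f.stronglyMeasurable.enorm.pow_const 2)
    (norm_invariant f.2.2.1)

theorem inner_eq_transversal (hq : IsRhoFunction N q) (hν : IsQuotientMeasure N μG μN q ν)
    (f f' : IndPre γ ν) :
    inner ℂ f f' = ∫ g, inner ℂ (f g) (f' g) ∂(transversal μG μN q) := by
  rw [inner_def]
  refine integral_out hq hν (F := fun g => inner ℂ (f g) (f' g))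
    (f.stronglyMeasurable.inner f'.stronglyMeasurable).measurable fun n x => ?_
  rw [equivariant, equivariant, LinearIsometryEquiv.inner_map_map]

theorem memLp (hq : IsRhoFunction N q) (hν : IsQuotientMeasure N μG μN q ν) (f : IndPre γ ν) :
    MemLp (f : G → E) 2 (transversal μG μN q) := by
  refine ⟨f.stronglyMeasurable.aestronglyMeasurable, ?_⟩
  rw [eLpNorm_eq_lintegral_rpow_enorm_toReal (by simp) (by simp)]
  simp only [ENNReal.toReal_ofNat, ENNReal.rpow_ofNat]
  rw [← enorm_sq_eq_transversal hq hν]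
  exact ENNReal.rpow_lt_top_of_nonneg (by norm_num) (by simp)

/-- Equivariant functions embed isometrically, up to null functions, into `L²` of the transversal
measure, and that space is second countable. -/
theorem separableSpace [TopologicalSpace.SeparableSpace E] (hq : IsRhoFunction N q)
    (hν : IsQuotientMeasure N μG μN q ν) :
    TopologicalSpace.SeparableSpace (IndPre γ ν) := by
  let J : IndPre γ ν → Lp E 2 (transversal μG μN q) := fun f => (f.memLp hq hν).toLp _
  have hJ : Isometry J := by
    intro f f'
    rw [edist_eq_enorm_sub, edist_eq_enorm_sub]
    have h1 : J f - J f' = J (f - f') := rfl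
    rw [h1]
    refine (ENNReal.pow_right_strictMono two_ne_zero).injective ?_
    change ‖J (f - f')‖ₑ ^ 2 = ‖f - f'‖ₑ ^ 2
    rw [enorm_sq_eq_transversal hq hν, Lp.enorm_toLp,
      eLpNorm_eq_lintegral_rpow_enorm_toReal (by simp) (by simp)]
    simp only [ENNReal.toReal_ofNat, ENNReal.rpow_ofNat]
    rw [← ENNReal.rpow_natCast, ← ENNReal.rpow_mul]
    norm_num
  have : Fact ((2 : ℝ≥0∞) ≠ ∞) := ⟨by simp⟩
  have : SecondCountableTopology (IndPre γ ν) :=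
    hJ.isUniformInducing.isInducing.secondCountableTopology
  infer_instance

end IndPre

theorem stronglyMeasurable_translate (hq : IsRhoFunction N q) {f : G → E}
    (hf : StronglyMeasurable f) :
    StronglyMeasurable fun p : G × G => translate q p.1 f p.2 := by
  have h : Continuous fun p : G × G => ((Real.sqrt (q (p.2 * p.1) / q p.2) : ℝ) : ℂ) := by
    have h1 : Continuous fun p : G × G => q (p.2 * p.1) / q p.2 :=
      (hq.continuous.comp (by fun_prop)).div (hq.continuous.comp (by fun_prop))
        fun p => (hq.pos p.2).ne'
    exact Complex.continuous_ofReal.comp (Real.continuous_sqrt.comp h1)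
  exact h.stronglyMeasurable.smul (hf.comp_measurable (by fun_prop))

theorem inducedRep_coe (hq : IsRhoFunction N q) (hν : IsQuotientMeasure N μG μN q ν) (a : G)
    (f : IndPre γ ν) :
    inducedRep γ hq hν a (f : IndSpace γ ν) = (indPreMap γ hq hν a f : IndPre γ ν) :=
  indMap_coe γ hq hν a f

/-- Measurability of the orbit maps of the induced representation. -/
theorem stronglyMeasurable_inducedRep [TopologicalSpace.SeparableSpace E]
    (hq : IsRhoFunction N q) (hν : IsQuotientMeasure N μG μN q ν) (v : IndSpace γ ν) :
    StronglyMeasurable fun g => inducedRep γ hq hν g v := by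
  have : TopologicalSpace.SeparableSpace (IndPre γ ν) := IndPre.separableSpace hq hν
  obtain ⟨κ, b, c, hc⟩ := exists_hilbertBasis_completion (IndPre γ ν)
  -- For functions, the coefficients against a countable basis are parametric integrals of jointly
  -- measurable integrands. A general vector is a limit of a sequence of functions.
  have hpre : ∀ f : IndPre γ ν,
      StronglyMeasurable fun g => inducedRep γ hq hν g (f : IndSpace γ ν) := by
    intro f
    refine stronglyMeasurable_of_inner c fun k => ?_
    simp_rw [hc, inducedRep_coe, UniformSpace.Completion.inner_coe,
      IndPre.inner_eq_transversal hq hν]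
    have h : StronglyMeasurable fun p : G × G => inner ℂ (b k p.2) (translate q p.1 f p.2) :=
      ((b k).stronglyMeasurable.comp_measurable measurable_snd).inner
        (stronglyMeasurable_translate hq f.stronglyMeasurable)
    exact h.integral_prod_right
  obtain ⟨s, hs, hlim⟩ := mem_closure_iff_seq_limit.1
    (UniformSpace.Completion.denseRange_coe (α := IndPre γ ν) v)
  choose f hf using hs
  refine stronglyMeasurable_of_tendsto Filter.atTop (fun n => hpre (f n)) ?_
  rw [tendsto_pi_nhds]
  intro g
  simp_rw [hf]
  exact ((inducedRep γ hq hν g).continuous.tendsto v).comp hlim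

end IndPre

/-! ### Pointwise form of `π(φ)` and the vectors representing its values. -/

section Kernel

variable {G : Type*} [Group G] [TopologicalSpace G] [IsTopologicalGroup G] [LocallyCompactSpace G]
variable [MeasurableSpace G] [SecondCountableTopology G] [T2Space G] [BorelSpace G]
variable {N : Subgroup G} [IsClosed (N : Set G)]
variable {E : Type*} [NormedAddCommGroup E] [InnerProductSpace ℂ E]
variable {μG : Measure G} [IsRightHaar μG] {μN : Measure N} [IsRightHaar μN]
variable {q : G → ℝ} {ν : Measure (RightCosets N)} {γ : UnitaryRep N E}

/-- On a compact `K`, the integral of `‖f‖² q` is a quotient integral of `‖f‖²` times the mass of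
`{n | n g ∈ K}`. These masses are uniformly bounded, `q` is bounded below on `K`, and `‖f‖ ≤ 1 +
‖f‖²` with `K` of finite measure. -/
theorem IndPre.locallyIntegrable (hq : IsRhoFunction N q) (hν : IsQuotientMeasure N μG μN q ν)
    (f : IndPre γ ν) : LocallyIntegrable (f : G → E) μG := by
  rw [locallyIntegrable_iff]
  intro K hK
  refine ⟨f.stronglyMeasurable.aestronglyMeasurable, ?_⟩
  obtain ⟨C, hC, hCle⟩ := fiber_compact_le (N := N) μN hK
  obtain ⟨c, hc⟩ : ∃ c : ℝ, ∀ g ∈ K, (q g)⁻¹ ≤ c := by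
    have h1 : ContinuousOn (fun g => (q g)⁻¹) K :=
      (hq.continuous.inv₀ fun g => (hq.pos g).ne').continuousOn
    obtain ⟨c, hc⟩ := hK.exists_bound_of_continuousOn h1
    exact ⟨c, fun g hg => (le_abs_self _).trans (hc g hg)⟩
  have hm2 : Measurable fun g => ‖f g‖ₑ ^ 2 := f.stronglyMeasurable.enorm.pow_const 2
  have hqm : Measurable fun g => ENNReal.ofReal (q g) := hq.continuous.measurable.ennreal_ofReal
  have h1 : ∫⁻ g, K.indicator 1 g * ‖f g‖ₑ ^ 2 * ENNReal.ofReal (q g) ∂μG < ∞ := by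
    rw [← lintegral_lintegral_fiber hq hν (F := fun g => K.indicator 1 g * ‖f g‖ₑ ^ 2)
      ((measurable_one.indicator hK.measurableSet).mul hm2)]
    refine lt_of_le_of_lt (lintegral_mono (g := fun g => C * ‖f g‖ₑ ^ 2) fun g => ?_) ?_
    · have hs : MeasurableSet {n : N | (n : G) * g ∈ K} :=
        (by fun_prop : Measurable fun n : N => (n : G) * g) hK.measurableSet
      have h2 : ∀ n : N, K.indicator (1 : G → ℝ≥0∞) (n * g) * ‖f (n * g)‖ₑ ^ 2
          = {n : N | (n : G) * g ∈ K}.indicator 1 n * ‖f g‖ₑ ^ 2 := fun n => by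
        rw [norm_invariant f.2.2.1]
        rfl
      simp_rw [h2]
      rw [lintegral_mul_const _ (measurable_one.indicator hs), lintegral_indicator_one hs]
      gcongr
      exact hCle g
    · rw [lintegral_const_mul _ hm2, ← IndPre.enorm_sq_eq_transversal hq hν]
      exact ENNReal.mul_lt_top hC.lt_top (by simp)
  refine lt_of_le_of_lt (lintegral_mono_ae (g := fun g => 1 + ENNReal.ofReal c *
    (K.indicator 1 g * ‖f g‖ₑ ^ 2 * ENNReal.ofReal (q g))) ?_) ?_
  · filter_upwards [ae_restrict_mem hK.measurableSet] with g hg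
    have h2 : ‖f g‖ₑ ≤ 1 + ‖f g‖ₑ ^ 2 := by
      rcases le_total ‖f g‖ₑ 1 with h | h
      · exact h.trans le_self_add
      · refine le_trans ?_ le_add_self
        rw [sq]
        exact le_mul_of_one_le_left' h
    refine h2.trans ?_
    gcongr
    have h3 : 1 ≤ ENNReal.ofReal c * ENNReal.ofReal (q g) := by
      rw [← ENNReal.ofReal_mul' (hq.pos g).le, ENNReal.one_le_ofReal]
      calc (1 : ℝ) = (q g)⁻¹ * q g := (inv_mul_cancel₀ (hq.pos g).ne').symm
        _ ≤ c * q g := by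
          have := hq.pos g
          gcongr
          exact hc g hg
    calc ‖f g‖ₑ ^ 2 ≤ (ENNReal.ofReal c * ENNReal.ofReal (q g)) * ‖f g‖ₑ ^ 2 :=
          le_mul_of_one_le_left' h3
      _ = _ := by simp [hg]; ring
  · rw [lintegral_add_left measurable_const]
    refine ENNReal.add_lt_top.2 ⟨?_, ?_⟩
    · simpa using hK.measure_lt_top
    · rw [lintegral_const_mul' _ _ ENNReal.ofReal_ne_top]
      refine ENNReal.mul_lt_top ENNReal.ofReal_lt_top ?_
      exact (setLIntegral_le_lintegral _ _).trans_lt h1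

theorem IndPre.integrable_smul (hq : IsRhoFunction N q) (hν : IsQuotientMeasure N μG μN q ν)
    (f : IndPre γ ν) {F : G → ℂ} (hF : Continuous F) (hc : HasCompactSupport F) :
    Integrable (fun g => F g • f g) μG :=
  (f.locallyIntegrable hq hν).integrable_smul_left_of_hasCompactSupport hF hc

/-- The function `y ↦ φ(x⁻¹ y) q(y)^{-1/2}`. -/
noncomputable def shifted (q : G → ℝ) (φ : G → ℂ) (x y : G) : ℂ :=
  φ (x⁻¹ * y) * ((Real.sqrt (q y))⁻¹ : ℝ)

theorem continuous_shifted (hq : IsRhoFunction N q) {φ : G → ℂ} (hφ : Continuous φ) (x : G) :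
    Continuous (shifted q φ x) := by
  have h1 : Continuous fun y => (Real.sqrt (q y))⁻¹ :=
    (Real.continuous_sqrt.comp hq.continuous).inv₀ fun y => (Real.sqrt_pos.2 (hq.pos y)).ne'
  unfold shifted
  fun_prop

theorem hasCompactSupport_shifted {φ : G → ℂ} (hc : HasCompactSupport φ) (x : G) :
    HasCompactSupport (shifted q φ x) :=
  (hc.comp_homeomorph (Homeomorph.mulLeft x⁻¹)).mul_right

/-- `(π(φ) f)(x) = ∫ φ(g) (π(g) f)(x) dg`, pointwise. -/
noncomputable def pointwiseOp (μG : Measure G) (q : G → ℝ) (φ : G → ℂ) (f : G → E) (x : G) : E :=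
  ∫ g, φ g • translate q g f x ∂μG

/-- Apart from a constant in `g`, the integrand depends on `x g` alone, so a left translation moves
the `x`-dependence into `shifted`. The factor `q(x g)` is split off because quotient integrals
unfold to integrals against `q dg`. -/
theorem smul_translate_eq (hq : IsRhoFunction N q) (φ : G → ℂ) (f : G → E) (x g : G) :
    φ g • translate q g f x
      = ((Real.sqrt (q x))⁻¹ : ℂ) •
        (((q (x * g) : ℂ) * shifted q φ x (x * g)) • f (x * g)) := by
  rw [translate, shifted, inv_mul_cancel_left, smul_smul, smul_smul]
  congr 1
  have h1 := (Real.sqrt_pos.2 (hq.pos (x * g))).ne'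
  have h2 : q (x * g) = Real.sqrt (q (x * g)) * Real.sqrt (q (x * g)) :=
    (Real.mul_self_sqrt (hq.pos _).le).symm
  have h3 : Real.sqrt (q (x * g) / q x)
      = (Real.sqrt (q x))⁻¹ * (q (x * g) * (Real.sqrt (q (x * g)))⁻¹) := by
    rw [Real.sqrt_div (hq.pos _).le]
    nth_rewrite 2 [h2]
    field_simp
  rw [h3]
  push_cast
  ring

/-- Local integrability gives this at every `x`, not merely almost every one, so point evaluations
after `π(φ)` are meaningful. -/
theorem integrable_smul_translate (hq : IsRhoFunction N q) (hν : IsQuotientMeasure N μG μN q ν)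
    {φ : G → ℂ} (hφ : Continuous φ) (hc : HasCompactSupport φ) (f : IndPre γ ν) (x : G) :
    Integrable (fun g => φ g • translate q g f x) μG := by
  simp_rw [smul_translate_eq hq]
  refine Integrable.smul _ ?_
  have h1 : Integrable (fun y => ((q y : ℂ) * shifted q φ x y) • f y) μG := by
    refine f.integrable_smul hq hν ?_ (hasCompactSupport_shifted hc x).mul_left
    exact (Complex.continuous_ofReal.comp hq.continuous).mul (continuous_shifted hq hφ x)
  have h2 : Integrable (fun y => ((q y : ℂ) * shifted q φ x y) • f y)
      (μG.map (MeasurableEquiv.mulLeft x)) := by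
    have h3 : μG.map (MeasurableEquiv.mulLeft x) = ENNReal.ofReal (modular x⁻¹) • μG := by
      have := map_inv_mul_left μG x⁻¹
      rwa [inv_inv] at this
    rw [h3]
    exact h1.smul_measure ENNReal.ofReal_ne_top
  exact (integrable_map_equiv _ _).1 h2

theorem inner_pointwiseOp [CompleteSpace E] (hq : IsRhoFunction N q)
    (hν : IsQuotientMeasure N μG μN q ν)
    {φ : G → ℂ} (hφ : Continuous φ) (hc : HasCompactSupport φ) (f : IndPre γ ν) (x : G) (e : E) :
    inner ℂ e (pointwiseOp μG q φ f x)
      = ((modular x)⁻¹ * (Real.sqrt (q x))⁻¹ : ℝ) *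
        ∫ y, (q y : ℂ) * (shifted q φ x y * inner ℂ e (f y)) ∂μG := by
  rw [pointwiseOp, ← integral_inner (integrable_smul_translate hq hν hφ hc f x)]
  simp_rw [smul_translate_eq hq, inner_smul_right]
  rw [integral_const_mul,
    integral_mul_left μG (fun y => (q y : ℂ) * shifted q φ x y * inner ℂ e (f y)) x, modular_inv,
    Complex.real_smul]
  simp_rw [mul_assoc]
  push_cast
  ring

theorem pointwiseOp_equivariant [CompleteSpace E] (hq : IsRhoFunction N q)
    (hν : IsQuotientMeasure N μG μN q ν)
    (φ : G → ℂ) (f : IndPre γ ν) (n : N) (x : G) :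
    pointwiseOp μG q φ f (n * x) = γ n (pointwiseOp μG q φ f x) := by
  have h : ∀ g, φ g • translate q g f (n * x)
      = (γ n).toContinuousLinearEquiv (φ g • translate q g f x) := by
    intro g
    have h1 := (translate_mem hq hν g f).2.1 n x
    rw [h1]
    exact ((γ n).map_smul _ _).symm
  rw [pointwiseOp]
  simp_rw [h]
  exact ContinuousLinearEquiv.integral_comp_comm (γ n).toContinuousLinearEquiv _

/-- Cauchy–Schwarz with a wasteful constant: `s t ≤ s² + t²` is integrated against `a ⊗ a`. It is
used for finiteness, so the factor 2 is harmless. -/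
theorem lintegral_sq_le {α : Type*} [MeasurableSpace α] (μ : Measure α) {a b : α → ℝ≥0∞}
    (ha : Measurable a) (hb : Measurable b) :
    (∫⁻ x, a x * b x ∂μ) ^ 2 ≤ 2 * (∫⁻ x, a x ∂μ) * ∫⁻ x, a x * b x ^ 2 ∂μ := by
  have hxy : ∀ s t : ℝ≥0∞, s * t ≤ s ^ 2 + t ^ 2 := by
    intro s t
    rcases le_total s t with h | h
    · calc s * t ≤ t * t := by gcongr
        _ = t ^ 2 := (sq t).symm
        _ ≤ _ := le_add_self
    · calc s * t ≤ s * s := by gcongr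
        _ = s ^ 2 := (sq s).symm
        _ ≤ _ := le_self_add
  set A := ∫⁻ x, a x ∂μ
  set B := ∫⁻ x, a x * b x ^ 2 ∂μ
  calc (∫⁻ x, a x * b x ∂μ) ^ 2
      = ∫⁻ x, ∫⁻ y, (a x * b x) * (a y * b y) ∂μ ∂μ := by
        rw [sq, ← lintegral_mul_const _ (by fun_prop)]
        exact lintegral_congr fun x => (lintegral_const_mul _ (by fun_prop)).symm
    _ ≤ ∫⁻ x, ∫⁻ y, ((a x * b x ^ 2) * a y + a x * (a y * b y ^ 2)) ∂μ ∂μ := by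
        refine lintegral_mono fun x => lintegral_mono fun y => ?_
        calc (a x * b x) * (a y * b y) = (a x * a y) * (b x * b y) := by ring
          _ ≤ (a x * a y) * (b x ^ 2 + b y ^ 2) := by gcongr; exact hxy _ _
          _ = _ := by ring
    _ = ∫⁻ x, ((a x * b x ^ 2) * A + a x * B) ∂μ := by
        refine lintegral_congr fun x => ?_
        rw [lintegral_add_left (by fun_prop), lintegral_const_mul _ ha,
          lintegral_const_mul _ (by fun_prop)]
    _ = 2 * A * B := by
        rw [lintegral_add_left (by fun_prop), lintegral_mul_const _ (by fun_prop),
          lintegral_mul_const _ ha]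
        ring

/-- Square integrability follows from the weighted Cauchy–Schwarz bound and Tonelli, since every
translate of `f` has the same norm as `f`. -/
theorem pointwiseOp_mem [CompleteSpace E] (hq : IsRhoFunction N q)
    (hν : IsQuotientMeasure N μG μN q ν)
    {φ : G → ℂ} (hφ : Continuous φ) (hc : HasCompactSupport φ) (f : IndPre γ ν) :
    pointwiseOp μG q φ f ∈ indSubmodule γ ν := by
  have hst := stronglyMeasurable_translate hq f.stronglyMeasurable
  have hsm : StronglyMeasurable (pointwiseOp μG q φ f) := by
    have h : StronglyMeasurable fun p : G × G => φ p.2 • translate q p.2 f p.1 :=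
      (hφ.stronglyMeasurable.comp_measurable measurable_snd).smul
        (hst.comp_measurable measurable_swap)
    exact h.integral_prod_right
  refine ⟨hsm, pointwiseOp_equivariant hq hν φ f, ?_⟩
  rw [lintegral_out hq hν (F := fun g => ‖pointwiseOp μG q φ f g‖ₑ ^ 2) (hsm.enorm.pow_const 2)
    (norm_invariant (pointwiseOp_equivariant hq hν φ f))]
  have ha : Measurable fun g => ‖φ g‖ₑ := by fun_prop
  have hA : ∫⁻ g, ‖φ g‖ₑ ∂μG < ∞ := (hφ.integrable_of_hasCompactSupport hc).2
  have hb : Measurable fun p : G × G => ‖translate q p.1 f p.2‖ₑ := hst.enorm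
  have hjoint : Measurable fun p : G × G => ‖φ p.2‖ₑ * ‖translate q p.2 f p.1‖ₑ ^ 2 :=
    (ha.comp measurable_snd).mul ((hb.comp measurable_swap).pow_const 2)
  calc ∫⁻ x, ‖pointwiseOp μG q φ f x‖ₑ ^ 2 ∂(transversal μG μN q)
      ≤ ∫⁻ x, 2 * (∫⁻ g, ‖φ g‖ₑ ∂μG) * ∫⁻ g, ‖φ g‖ₑ * ‖translate q g f x‖ₑ ^ 2 ∂μG
          ∂(transversal μG μN q) := by
        refine lintegral_mono fun x => ?_
        refine le_trans ?_ (lintegral_sq_le μG ha (hb.comp measurable_prodMk_right))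
        gcongr
        refine (enorm_integral_le_lintegral_enorm _).trans_eq ?_
        exact lintegral_congr fun g => enorm_smul _ _
    _ = 2 * (∫⁻ g, ‖φ g‖ₑ ∂μG) * ∫⁻ g, ∫⁻ x, ‖φ g‖ₑ * ‖translate q g f x‖ₑ ^ 2
          ∂(transversal μG μN q) ∂μG := by
        rw [lintegral_const_mul _ hjoint.lintegral_prod_right', lintegral_lintegral_swap]
        exact hjoint.aemeasurable
    _ = 2 * (∫⁻ g, ‖φ g‖ₑ ∂μG) * ∫⁻ g, ‖φ g‖ₑ * ‖f‖ₑ ^ 2 ∂μG := by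
        congr 1
        refine lintegral_congr fun g => ?_
        have h0 : ‖φ g‖ₑ ≠ ∞ := enorm_ne_top
        rw [lintegral_const_mul' _ _ h0]
        congr 1
        have h1 := IndPre.enorm_sq_eq_transversal hq hν (indPreMap γ hq hν g f)
        rw [← ofReal_norm, (indPreMap γ hq hν g).norm_map, ofReal_norm] at h1
        exact h1.symm
    _ < ∞ := by
        rw [lintegral_mul_const _ ha]
        exact ENNReal.mul_lt_top (ENNReal.mul_lt_top (by simp) hA)
          (ENNReal.mul_lt_top hA (by simp))

/-- The Hilbert space valued integral and the pointwise one have the same inner products with the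
dense set of functions, by Fubini over `G` and the transversal. -/
theorem integrated_inducedRep_coe [CompleteSpace E] [TopologicalSpace.SeparableSpace E]
    (hq : IsRhoFunction N q) (hν : IsQuotientMeasure N μG μN q ν)
    {φ : G → ℂ} (hφ : Continuous φ) (hc : HasCompactSupport φ) (f F : IndPre γ ν)
    (hF : (F : G → E) = pointwiseOp μG q φ f) :
    integrated μG (inducedRep γ hq hν) φ (f : IndSpace γ ν) = (F : IndSpace γ ν) := by
  have hφi := hφ.integrable_of_hasCompactSupport hc (μ := μG)
  have hst := stronglyMeasurable_translate hq f.stronglyMeasurable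
  refine ext_inner_left ℂ fun v => ?_
  induction v using UniformSpace.Completion.induction_on with
  | hp => exact isClosed_eq (by fun_prop) (by fun_prop)
  | ih u =>
    rw [inner_integrated μG (stronglyMeasurable_inducedRep hq hν) hφi]
    simp_rw [inducedRep_coe, UniformSpace.Completion.inner_coe,
      IndPre.inner_eq_transversal hq hν, hF, ← integral_const_mul]
    have hjm : StronglyMeasurable fun p : G × G => φ p.1 * inner ℂ (u p.2) (translate q p.1 f p.2) :=
      (hφ.stronglyMeasurable.comp_measurable measurable_fst).mul
        ((u.stronglyMeasurable.comp_measurable measurable_snd).inner hst)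
    have hi : Integrable (fun p : G × G => φ p.1 * inner ℂ (u p.2) (translate q p.1 f p.2))
        (μG.prod (transversal μG μN q)) := by
      refine ⟨hjm.aestronglyMeasurable, ?_⟩
      rw [HasFiniteIntegral, lintegral_prod _ hjm.enorm.aemeasurable]
      refine lt_of_le_of_lt (lintegral_mono
        (g := fun g => ‖φ g‖ₑ * (‖u‖ₑ ^ 2 + ‖f‖ₑ ^ 2)) fun g => ?_) ?_
      · have h1 := IndPre.enorm_sq_eq_transversal hq hν (indPreMap γ hq hν g f)
        rw [← ofReal_norm, (indPreMap γ hq hν g).norm_map, ofReal_norm] at h1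
        rw [h1, IndPre.enorm_sq_eq_transversal hq hν u,
          ← lintegral_add_left (u.stronglyMeasurable.enorm.pow_const 2)]
        beta_reduce
        have h0 : ‖φ g‖ₑ ≠ ∞ := enorm_ne_top
        rw [← lintegral_const_mul' _ _ h0]
        refine lintegral_mono fun x => ?_
        rw [enorm_mul]
        gcongr
        change ‖inner ℂ (u x) (translate q g f x)‖ₑ ≤ ‖u x‖ₑ ^ 2 + ‖translate q g f x‖ₑ ^ 2
        have h : ‖inner ℂ (u x) (translate q g f x)‖
            ≤ ‖u x‖ ^ 2 + ‖translate q g f x‖ ^ 2 := by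
          have := norm_inner_le_norm (𝕜 := ℂ) (u x) (translate q g f x)
          nlinarith [sq_nonneg (‖u x‖ - ‖translate q g f x‖), sq_nonneg ‖u x‖,
            sq_nonneg ‖translate q g f x‖]
        have h' : ‖inner ℂ (u x) (translate q g f x)‖₊
            ≤ ‖u x‖₊ ^ 2 + ‖translate q g f x‖₊ ^ 2 := by exact_mod_cast h
        simp only [enorm_eq_nnnorm]
        exact_mod_cast h'
      · rw [lintegral_mul_const _ (by fun_prop)]
        exact ENNReal.mul_lt_top hφi.2 (ENNReal.add_lt_top.2 ⟨by simp, by simp⟩)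
    refine (integral_integral_swap hi).trans (integral_congr_ae (Filter.Eventually.of_forall
      fun x => ?_))
    beta_reduce
    rw [pointwiseOp, ← integral_inner (integrable_smul_translate hq hν hφ hc f x)]
    simp_rw [inner_smul_right]
    rfl

/-- The equivariant function `y ↦ ∫_N conj F(n y) γ(n)⁻¹ e dn`. -/
noncomputable def average (μN : Measure N) (γ : UnitaryRep N E) (F : G → ℂ) (e : E) (y : G) : E :=
  ∫ n : N, (starRingEnd ℂ) (F (n * y)) • γ n⁻¹ e ∂μN

theorem continuous_average_integrand {F : G → ℂ} (hF : Continuous F) (e : E) :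
    Continuous fun p : G × N => (starRingEnd ℂ) (F (p.2 * p.1)) • γ p.2⁻¹ e := by
  have h1 : Continuous fun n : N => γ n⁻¹ e := (γ.continuous_apply e).comp continuous_inv
  have h2 : Continuous fun p : G × N => γ p.2⁻¹ e := h1.comp continuous_snd
  have h3 : Continuous fun p : G × N => (starRingEnd ℂ) (F (p.2 * p.1)) := by fun_prop
  exact h3.smul h2

theorem hasCompactSupport_fiber {F : G → ℂ} (hc : HasCompactSupport F) (y : G) :
    HasCompactSupport fun n : N => F (n * y) :=
  (hc.comp_homeomorph (Homeomorph.mulRight y)).comp_isClosedEmbedding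
    (IsClosed.isClosedEmbedding_subtypeVal (X := G) (s := N) ‹_›)

theorem integrable_average_integrand {F : G → ℂ} (hF : Continuous F) (hc : HasCompactSupport F)
    (e : E) (y : G) :
    Integrable (fun n : N => (starRingEnd ℂ) (F (n * y)) • γ n⁻¹ e) μN := by
  refine Continuous.integrable_of_hasCompactSupport ?_ ?_
  · exact (continuous_average_integrand hF e).comp (Continuous.prodMk_right y)
  · exact HasCompactSupport.smul_right ((hasCompactSupport_fiber hc y).comp_left (map_zero _))

/-- Equivariance is the substitution `n ↦ n n₀`. The norm is at most `κ(y) ‖e‖` with `κ(y) = ∫_N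
|F(n y)| dn`; this `κ` is bounded, and its transversal integral is `∫ |F| q < ∞`, so `κ²` is
integrable too. -/
theorem average_mem [CompleteSpace E] (hq : IsRhoFunction N q) (hν : IsQuotientMeasure N μG μN q ν)
    {F : G → ℂ} (hF : Continuous F) (hc : HasCompactSupport F) (e : E) :
    average μN γ F e ∈ indSubmodule γ ν := by
  have hsm : StronglyMeasurable (average μN γ F e) :=
    (continuous_average_integrand hF e).stronglyMeasurable.integral_prod_right
  have heq : ∀ (n : N) (g : G), average μN γ F e (n * g) = γ n (average μN γ F e g) := by
    intro n₀ g
    have h1 := integral_mul_right_eq_self (μ := μN)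
      (fun n : N => (starRingEnd ℂ) (F (n * g)) • γ (n * n₀⁻¹)⁻¹ e) n₀
    have h2 : ∀ n : N, (starRingEnd ℂ) (F (n * g)) • γ (n * n₀⁻¹)⁻¹ e
        = (γ n₀).toContinuousLinearEquiv ((starRingEnd ℂ) (F (n * g)) • γ n⁻¹ e) := by
      intro n
      rw [mul_inv_rev, inv_inv]
      refine Eq.trans ?_ ((γ n₀).map_smul _ _).symm
      congr 1
      change γ.toHom (n₀ * n⁻¹) e = γ.toHom n₀ (γ.toHom n⁻¹ e)
      rw [map_mul]
      rfl
    simp only [mul_inv_cancel_right] at h1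
    rw [average, average]
    refine Eq.trans ?_ (h1.trans ?_)
    · simp [mul_assoc]
    · simp_rw [h2]
      exact ContinuousLinearEquiv.integral_comp_comm (γ n₀).toContinuousLinearEquiv _
  refine ⟨hsm, heq, ?_⟩
  rw [lintegral_out hq hν (F := fun g => ‖average μN γ F e g‖ₑ ^ 2) (hsm.enorm.pow_const 2)
    (norm_invariant heq)]
  let κ : G → ℝ≥0∞ := fun y => ∫⁻ n : N, ‖F (n * y)‖ₑ ∂μN
  have hFm : Measurable fun g => ‖F g‖ₑ := by fun_prop
  have hκm : Measurable κ := measurable_fiber μN hFm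
  have hle : ∀ y, ‖average μN γ F e y‖ₑ ≤ κ y * ‖e‖ₑ := by
    intro y
    refine (enorm_integral_le_lintegral_enorm _).trans_eq ?_
    have hFn : Measurable fun n : N => ‖F (n * y)‖ₑ :=
      hFm.comp (by fun_prop : Measurable fun n : N => (n : G) * y)
    simp only [κ]
    rw [← lintegral_mul_const _ hFn]
    refine lintegral_congr fun n => ?_
    rw [enorm_smul]
    congr 1
    · rw [← ofReal_norm, RCLike.norm_conj, ofReal_norm]
    · rw [← ofReal_norm, LinearIsometryEquiv.norm_map, ofReal_norm]
  obtain ⟨C, hC, hCle⟩ := fiber_compact_le (N := N) μN hc.isCompact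
  obtain ⟨M, hM⟩ := hc.exists_bound_of_continuous hF
  have hκ : ∀ y, κ y ≤ ENNReal.ofReal M * C := by
    intro y
    have hs : MeasurableSet {n : N | (n : G) * y ∈ tsupport F} :=
      (by fun_prop : Measurable fun n : N => (n : G) * y) hc.isCompact.measurableSet
    calc κ y ≤ ∫⁻ n : N, ENNReal.ofReal M * {n : N | (n : G) * y ∈ tsupport F}.indicator 1 n ∂μN := by
          refine lintegral_mono fun n => ?_
          by_cases hn : (n : G) * y ∈ tsupport F
          · have : n ∈ {n : N | (n : G) * y ∈ tsupport F} := hn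
            rw [Set.indicator_of_mem this, Pi.one_apply, mul_one, ← ofReal_norm]
            exact ENNReal.ofReal_le_ofReal (hM _)
          · rw [image_eq_zero_of_notMem_tsupport hn]
            simp
      _ = ENNReal.ofReal M * μN {n : N | (n : G) * y ∈ tsupport F} := by
          rw [lintegral_const_mul _ (measurable_one.indicator hs), lintegral_indicator_one hs]
      _ ≤ _ := by gcongr; exact hCle y
  have hκi : ∫⁻ y, κ y ∂(transversal μG μN q) < ∞ := by
    rw [lintegral_lintegral_fiber hq hν hFm]
    have hi : Integrable (fun g => F g * (q g : ℂ)) μG :=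
      (hF.mul (Complex.continuous_ofReal.comp hq.continuous)).integrable_of_hasCompactSupport
        hc.mul_right
    refine lt_of_le_of_lt (le_of_eq (lintegral_congr fun g => ?_)) hi.2
    rw [enorm_mul]
    congr 1
    rw [← ofReal_norm, Complex.norm_real, Real.norm_of_nonneg (hq.pos g).le]
  calc ∫⁻ y, ‖average μN γ F e y‖ₑ ^ 2 ∂(transversal μG μN q)
      ≤ ∫⁻ y, (ENNReal.ofReal M * C * ‖e‖ₑ ^ 2) * κ y ∂(transversal μG μN q) := by
        refine lintegral_mono fun y => ?_
        calc ‖average μN γ F e y‖ₑ ^ 2 ≤ (κ y * ‖e‖ₑ) ^ 2 := by gcongr; exact hle y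
          _ = κ y * ‖e‖ₑ ^ 2 * κ y := by ring
          _ ≤ _ := by gcongr; exact hκ y
    _ < ∞ := by
        rw [lintegral_const_mul _ hκm]
        refine ENNReal.mul_lt_top (ENNReal.mul_lt_top ?_ (by simp)) hκi
        exact ENNReal.mul_lt_top (by simp) hC.lt_top

/-- The average as an element of the pre-Hilbert space. -/
noncomputable def averagePre [CompleteSpace E] (hq : IsRhoFunction N q)
    (hν : IsQuotientMeasure N μG μN q ν) (γ : UnitaryRep N E)
    {F : G → ℂ} (hF : Continuous F) (hc : HasCompactSupport F) (e : E) : IndPre γ ν :=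
  ⟨average μN γ F e, average_mem hq hν hF hc e⟩

/-- Unfolding: equivariance of `f` carries `γ(n)⁻¹` across as a shift of the argument, and the
integrals over `N` and `N \ G` combine to one over `G`. -/
theorem inner_averagePre [CompleteSpace E] (hq : IsRhoFunction N q)
    (hν : IsQuotientMeasure N μG μN q ν) {F : G → ℂ} (hF : Continuous F) (hc : HasCompactSupport F)
    (e : E) (f : IndPre γ ν) :
    inner ℂ (averagePre hq hν γ hF hc e) f = ∫ g, (q g : ℂ) * (F g * inner ℂ e (f g)) ∂μG := by
  have hsm : StronglyMeasurable fun g => F g * inner ℂ e (f g) :=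
    hF.stronglyMeasurable.mul (stronglyMeasurable_const.inner f.stronglyMeasurable)
  have hi : Integrable (fun g => (q g : ℂ) * (F g * inner ℂ e (f g))) μG := by
    have h1 := f.integrable_smul hq hν (F := fun g => (q g : ℂ) * F g)
      ((Complex.continuous_ofReal.comp hq.continuous).mul hF) hc.mul_left
    refine (h1.const_inner e).congr (Filter.Eventually.of_forall fun g => ?_)
    beta_reduce
    rw [inner_smul_right, mul_assoc]
  rw [← integral_integral_fiber hq hν hsm hi, IndPre.inner_eq_transversal hq hν]
  refine integral_congr_ae (Filter.Eventually.of_forall fun y => ?_)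
  change inner ℂ (average μN γ F e y) (f y) = _
  rw [average, ← inner_conj_symm,
    ← integral_inner (integrable_average_integrand hF hc e y), ← integral_conj]
  refine integral_congr_ae (Filter.Eventually.of_forall fun n => ?_)
  have h : inner ℂ (γ n⁻¹ e) (f y) = inner ℂ e (f (n * y)) := by
    rw [f.equivariant, ← (γ n).inner_map_map (γ n⁻¹ e) (f y)]
    congr 1
    change γ.toHom n (γ.toHom n⁻¹ e) = e
    rw [map_inv]
    exact (γ.toHom n).apply_symm_apply e
  beta_reduce
  rw [inner_smul_right, map_mul, inner_conj_symm, h, Complex.conj_conj]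

end Kernel

/-! ### The trace formula for a general induced representation. -/

section Trace

variable {G : Type*} [Group G] [TopologicalSpace G] [IsTopologicalGroup G] [LocallyCompactSpace G]
variable [MeasurableSpace G] [SecondCountableTopology G] [T2Space G] [BorelSpace G]
variable {N : Subgroup G} [IsClosed (N : Set G)]
variable {E : Type*} [NormedAddCommGroup E] [InnerProductSpace ℂ E] [CompleteSpace E]
variable {μG : Measure G} [IsRightHaar μG] {μN : Measure N} [IsRightHaar μN]
variable {q : G → ℝ} {ν : Measure (RightCosets N)} {γ : UnitaryRep N E}

theorem IsRhoFunction.apply_mul (hq : IsRhoFunction N q) (n : N) (g : G) :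
    q (n * g) = q n * q g := by
  have h := hq.map_mul n 1
  rw [mul_one, hq.map_one, mul_one] at h
  rw [hq.map_mul, ← h]

/-- The quadratic form of the diagonal value at `x` of the kernel of `π(ψ)`, up to a factor. -/
noncomputable def fiberForm (μN : Measure N) (q : G → ℝ) (γ : UnitaryRep N E) (ψ : G → ℂ) (x : G)
    (e : E) : ℂ :=
  ∫ n : N, ψ (x⁻¹ * n * x) * ((Real.sqrt (q n))⁻¹ : ℝ) * inner ℂ e (γ n e) ∂μN

/-- Unfolding one of the two averages leaves an integral over `G × N` with continuous, compactly
supported integrand. For fixed `n`, the integral over `G` is a convolution value at `x⁻¹ n x`, and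
moving `x` out of the argument costs `Δ(x)`. -/
theorem norm_averagePre_sq (hq : IsRhoFunction N q) (hν : IsQuotientMeasure N μG μN q ν)
    {φ : G → ℂ} (hφ : Continuous φ) (hc : HasCompactSupport φ) (x : G) (e : E) :
    ((‖averagePre hq hν γ (continuous_shifted hq hφ x) (hasCompactSupport_shifted hc x) e‖ ^ 2 : ℝ)
      : ℂ) = modular x * fiberForm μN q γ (conv μG φ (involution φ)) x e := by
  set F := shifted q φ x with hFdef
  have hF : Continuous F := continuous_shifted hq hφ x
  have hFc : HasCompactSupport F := hasCompactSupport_shifted hc x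
  set k : IndPre γ ν := averagePre hq hν γ hF hFc e with hk
  have hinv : ∀ n : N, inner ℂ e (γ n⁻¹ e) = (starRingEnd ℂ) (inner ℂ e (γ n e)) := by
    intro n
    rw [inner_conj_symm, ← (γ n).inner_map_map e (γ n⁻¹ e)]
    congr 1
    change γ.toHom n (γ.toHom n⁻¹ e) = e
    rw [map_inv]
    exact (γ.toHom n).apply_symm_apply e
  let Ψ : G × N → ℂ := fun p => (q p.1 : ℂ) * (F p.1 * ((starRingEnd ℂ) (F (p.2 * p.1)) *
    inner ℂ e (γ p.2⁻¹ e)))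
  have hΨc : Continuous Ψ := by
    have h1 : Continuous fun n : N => inner ℂ e (γ n⁻¹ e) :=
      continuous_const.inner ((γ.continuous_apply e).comp continuous_inv)
    have h2 : Continuous fun p : G × N => inner ℂ e (γ p.2⁻¹ e) := h1.comp continuous_snd
    have h3 : Continuous fun p : G × N => (q p.1 : ℂ) :=
      Complex.continuous_ofReal.comp (hq.continuous.comp continuous_fst)
    have h4 : Continuous fun p : G × N => (starRingEnd ℂ) (F (p.2 * p.1)) := by fun_prop
    exact h3.mul ((hF.comp continuous_fst).mul (h4.mul h2))
  have hΨs : HasCompactSupport Ψ := by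
    have hN : IsCompact (((↑) : N → G) ⁻¹' (tsupport F * (tsupport F)⁻¹)) :=
      (IsClosed.isClosedEmbedding_subtypeVal (X := G) (s := N) ‹_›).isCompact_preimage
        (hFc.isCompact.mul hFc.isCompact.inv)
    refine HasCompactSupport.intro (hFc.isCompact.prod hN) fun p hp => ?_
    by_cases h1 : p.1 ∈ tsupport F
    · by_cases h2 : (p.2 : G) * p.1 ∈ tsupport F
      · exact absurd ⟨h1, p.2 * p.1, h2, p.1⁻¹, Set.inv_mem_inv.2 h1, by simp⟩ hp
      · simp [Ψ, image_eq_zero_of_notMem_tsupport h2]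
    · simp [Ψ, image_eq_zero_of_notMem_tsupport h1]
  have hΨi : Integrable Ψ (μG.prod μN) := hΨc.integrable_of_hasCompactSupport hΨs
  have h1 : ((‖k‖ ^ 2 : ℝ) : ℂ) = ∫ y, ∫ n : N, Ψ (y, n) ∂μN ∂μG := by
    have h2 : inner ℂ k k = ((‖k‖ ^ 2 : ℝ) : ℂ) := by
      rw [inner_self_eq_norm_sq_to_K]; norm_cast
    rw [← h2, hk, inner_averagePre hq hν hF hFc e]
    refine integral_congr_ae (Filter.Eventually.of_forall fun y => ?_)
    change (q y : ℂ) * (F y * inner ℂ e (average μN γ F e y)) = _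
    simp only [Ψ]
    rw [average, ← integral_inner (integrable_average_integrand hF hFc e y), integral_const_mul,
      integral_const_mul]
    simp_rw [inner_smul_right]
  have h2 : ∀ n : N, ∫ y, Ψ (y, n) ∂μG = modular x * (starRingEnd ℂ)
      (conv μG φ (involution φ) (x⁻¹ * n * x) * ((Real.sqrt (q n))⁻¹ : ℝ) *
        inner ℂ e (γ n e)) := by
    intro n
    have h3 : ∀ y, Ψ (y, n) = (φ (x⁻¹ * y) * (starRingEnd ℂ) (φ (x⁻¹ * (n * y)))) *
        (((Real.sqrt (q n))⁻¹ : ℝ) * (starRingEnd ℂ) (inner ℂ e (γ n e))) := by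
      intro y
      -- Multiplicativity of `q` along `N` removes all dependence on `y`.
      have hs : q y * ((Real.sqrt (q y))⁻¹ * (Real.sqrt (q (n * y)))⁻¹) = (Real.sqrt (q n))⁻¹ := by
        rw [hq.apply_mul, Real.sqrt_mul (hq.pos _).le]
        have h4 := (Real.sqrt_pos.2 (hq.pos y)).ne'
        have h5 := (Real.sqrt_pos.2 (hq.pos n)).ne'
        have h6 : q y = Real.sqrt (q y) * Real.sqrt (q y) :=
          (Real.mul_self_sqrt (hq.pos _).le).symm
        nth_rewrite 1 [h6]
        field_simp
      rw [← hs, ← hinv]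
      simp only [Ψ, F, shifted, map_mul, Complex.conj_ofReal]
      push_cast
      ring
    simp_rw [h3]
    rw [integral_mul_const]
    have h4 := integral_mul_left μG
      (fun y => φ (x⁻¹ * y) * (starRingEnd ℂ) (φ (x⁻¹ * (n * y)))) x
    simp only [inv_mul_cancel_left, modular_inv, Complex.real_smul] at h4
    have h5 : ∫ y, φ (x⁻¹ * y) * (starRingEnd ℂ) (φ (x⁻¹ * (n * y))) ∂μG
        = modular x * ∫ y, φ y * (starRingEnd ℂ) (φ (x⁻¹ * (n * (x * y)))) ∂μG := by
      rw [h4, ← mul_assoc, Complex.ofReal_inv,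
        mul_inv_cancel₀ (Complex.ofReal_ne_zero.2 (modular_pos x).ne'), one_mul]
    rw [h5, conv_involution_apply, map_mul, map_mul, ← integral_conj, Complex.conj_ofReal]
    simp only [map_mul, Complex.conj_conj, mul_assoc]
    congr 2
    refine integral_congr_ae (Filter.Eventually.of_forall fun y => ?_)
    exact mul_comm _ _
  have h3 : ((‖k‖ ^ 2 : ℝ) : ℂ)
      = modular x * (starRingEnd ℂ) (fiberForm μN q γ (conv μG φ (involution φ)) x e) := by
    rw [h1, integral_integral_swap hΨi, fiberForm, ← integral_conj, ← integral_const_mul]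
    exact integral_congr_ae (Filter.Eventually.of_forall h2)
  -- The left side is real, so the conjugate on the form can be dropped.
  have h4 := congrArg (starRingEnd ℂ) h3
  rwa [Complex.conj_ofReal, map_mul, Complex.conj_conj, Complex.conj_ofReal] at h4

/-- The vector representing `f ↦ ⟨e, (π(φ) f)(x)⟩`. -/
noncomputable def kernelVector (hq : IsRhoFunction N q) (hν : IsQuotientMeasure N μG μN q ν)
    (γ : UnitaryRep N E) {φ : G → ℂ} (hφ : Continuous φ) (hc : HasCompactSupport φ) (x : G)
    (e : E) : IndPre γ ν :=
  (((modular x)⁻¹ * (Real.sqrt (q x))⁻¹ : ℝ) : ℂ) •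
    averagePre hq hν γ (continuous_shifted hq hφ x) (hasCompactSupport_shifted hc x) e

theorem inner_kernelVector (hq : IsRhoFunction N q) (hν : IsQuotientMeasure N μG μN q ν)
    {φ : G → ℂ} (hφ : Continuous φ) (hc : HasCompactSupport φ) (x : G) (e : E)
    (f : IndPre γ ν) :
    inner ℂ (kernelVector hq hν γ hφ hc x e) f = inner ℂ e (pointwiseOp μG q φ f x) := by
  rw [kernelVector, inner_smul_left, inner_averagePre, Complex.conj_ofReal,
    inner_pointwiseOp hq hν hφ hc]

/-- The squared prefactor `Δ(x)⁻² q(x)⁻¹` meets the `Δ(x)` of `norm_averagePre_sq`. Being a positive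
multiple of a squared norm, the form is seen to be positive. -/
theorem norm_kernelVector_sq (hq : IsRhoFunction N q) (hν : IsQuotientMeasure N μG μN q ν)
    {φ : G → ℂ} (hφ : Continuous φ) (hc : HasCompactSupport φ) (x : G) (e : E) :
    fiberForm μN q γ (conv μG φ (involution φ)) x e
      = ((modular x * q x * ‖kernelVector hq hν γ hφ hc x e‖ ^ 2 : ℝ) : ℂ) := by
  have h := norm_averagePre_sq (γ := γ) hq hν hφ hc x e
  have h1 := (modular_pos x).ne'
  have h2 := (Real.sqrt_pos.2 (hq.pos x)).ne'
  have h3 : q x = Real.sqrt (q x) ^ 2 := (Real.sq_sqrt (hq.pos _).le).symm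
  rw [kernelVector, norm_smul, mul_pow, Complex.norm_real, Real.norm_eq_abs, sq_abs]
  set A := ‖averagePre hq hν γ (continuous_shifted hq hφ x) (hasCompactSupport_shifted hc x) e‖
  have h4 : modular x * q x * (((modular x)⁻¹ * (Real.sqrt (q x))⁻¹) ^ 2 * A ^ 2)
      = (modular x)⁻¹ * A ^ 2 := by
    nth_rewrite 1 [h3]
    field_simp
  rw [h4, Complex.ofReal_mul, h, ← mul_assoc, Complex.ofReal_inv,
    inv_mul_cancel₀ (Complex.ofReal_ne_zero.2 h1), one_mul]

theorem isPositiveOp_of_fiberForm (hq : IsRhoFunction N q) (hν : IsQuotientMeasure N μG μN q ν)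
    {φ : G → ℂ} (hφ : Continuous φ) (hc : HasCompactSupport φ) {x : G} {A : E → E} {a : ℝ}
    (ha : 0 < a) (hA : ∀ e, inner ℂ e (A e)
      = a * fiberForm μN q γ (conv μG φ (involution φ)) x e) : IsPositiveOp A := by
  intro e
  rw [hA, norm_kernelVector_sq hq hν hφ hc, ← Complex.ofReal_mul, Complex.ofReal_re,
    Complex.ofReal_im]
  have h1 := modular_pos x
  have h2 := hq.pos x
  exact ⟨by positivity, rfl⟩

/-- The trace formula for an induced representation. -/
theorem exists_trace_density [TopologicalSpace.SeparableSpace E]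
    (hq : IsRhoFunction N q) (hν : IsQuotientMeasure N μG μN q ν) (γ : UnitaryRep N E)
    {φ : G → ℂ} (hφ : Continuous φ) (hc : HasCompactSupport φ) :
    ∃ Φ : G → ℝ≥0∞, Measurable Φ ∧ (∀ (n : N) (g : G), Φ (n * g) = Φ g) ∧
      (∀ (x : G) (A : E → E) (a : ℝ), 0 < a → (∀ e, inner ℂ e (A e)
        = a * fiberForm μN q γ (conv μG φ (involution φ)) x e) →
        posTrace A = ENNReal.ofReal (a * modular x * q x) * Φ x) ∧
      posTrace (integrated μG (inducedRep γ hq hν) (conv μG φ (involution φ)))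
        = ∫⁻ g, Φ g ∂(transversal μG μN q) := by
  have : TopologicalSpace.SeparableSpace (IndPre γ ν) := IndPre.separableSpace hq hν
  obtain ⟨κ, b, c, hbc⟩ := exists_hilbertBasis_completion (IndPre γ ν)
  -- One choice of representatives serves all `x` at once; the density is the squared
  -- Hilbert–Schmidt norm of `f ↦ (π(φ) f)(x)` in the basis `b`.
  let T : κ → IndPre γ ν := fun k => ⟨pointwiseOp μG q φ (b k), pointwiseOp_mem hq hν hφ hc (b k)⟩
  have hm : ∀ k, Measurable fun g => ‖T k g‖ₑ ^ 2 := fun k =>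
    (T k).stronglyMeasurable.enorm.pow_const 2
  refine ⟨fun g => ∑' k, ‖T k g‖ₑ ^ 2, Measurable.tsum hm, fun n g => ?_,
    fun x A a ha hA => ?_, ?_⟩
  · exact tsum_congr fun k => norm_invariant (T k).2.2.1 n g
  · have h0 : 0 ≤ a * modular x * q x := by
      have h1 := modular_pos x
      have h2 := hq.pos x
      positivity
    -- Scaling the kernel vectors by `r` makes the form of `A` exactly a squared norm; the adjoint
    -- family is then `r` times the values at `x`, by `inner_kernelVector`.
    let r := Real.sqrt (a * modular x * q x)
    have hr : r ^ 2 = a * modular x * q x := Real.sq_sqrt h0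
    rw [posTrace_eq_tsum c
      (S := fun e => (r : ℂ) • (kernelVector hq hν γ hφ hc x e : IndSpace γ ν))
      (R := fun k => (r : ℂ) • T k x), ← ENNReal.tsum_mul_left]
    · refine tsum_congr fun k => ?_
      rw [enorm_smul, mul_pow, ← hr, ENNReal.ofReal_pow (Real.sqrt_nonneg _), ← ofReal_norm,
        Complex.norm_real, Real.norm_of_nonneg (Real.sqrt_nonneg _)]
    · intro e
      rw [hA, norm_kernelVector_sq hq hν hφ hc, ← Complex.ofReal_mul, Complex.ofReal_re,
        norm_smul, mul_pow, Complex.norm_real, Real.norm_of_nonneg (Real.sqrt_nonneg _), hr,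
        UniformSpace.Completion.norm_coe]
      ring
    · intro e k
      rw [inner_smul_left, inner_smul_right, Complex.conj_ofReal, hbc,
        UniformSpace.Completion.inner_coe, inner_kernelVector]
  · rw [posTrace_integrated_conv μG (stronglyMeasurable_inducedRep hq hν)
      (hφ.integrable_of_hasCompactSupport hc) hφ.stronglyMeasurable c,
      lintegral_tsum fun k => (hm k).aemeasurable]
    refine tsum_congr fun k => ?_
    rw [hbc, integrated_inducedRep_coe hq hν hφ hc (b k) (T k) rfl, ← ofReal_norm,
      UniformSpace.Completion.norm_coe, ofReal_norm]
    exact (T k).enorm_sq_eq_transversal hq hν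

end Trace

/-! ### Modular functions and quotient measures for `V ⋊ H`. -/

section SemidirectProduct

variable {V : Type*} [NormedAddCommGroup V] [NormedSpace ℝ V] [FiniteDimensional ℝ V]
variable [MeasurableSpace V] [BorelSpace V]

/-- The absolute value of the determinant. -/
noncomputable def absDet (h : GLGroup V) : ℝ := |LinearMap.det (h.val : V →ₗ[ℝ] V)|

theorem det_ne_zero (h : GLGroup V) : LinearMap.det (h.val : V →ₗ[ℝ] V) ≠ 0 := by
  have h1 : IsUnit (h.val : V →ₗ[ℝ] V) :=
    h.isUnit.map (ContinuousLinearMap.toLinearMapRingHom (R₁ := ℝ) (M₁ := V))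
  exact (h1.map LinearMap.det).ne_zero

theorem absDet_pos (h : GLGroup V) : 0 < absDet h := abs_pos.2 (det_ne_zero h)

theorem map_inv_smul (μV : Measure V) [μV.IsAddHaarMeasure] (h : GLGroup V) :
    μV.map (fun v => (h⁻¹).val v) = ENNReal.ofReal (absDet h) • μV := by
  have h1 := map_linearMap_addHaar_eq_smul_addHaar μV (det_ne_zero h⁻¹)
  have h2 : LinearMap.det ((h⁻¹).val : V →ₗ[ℝ] V) * LinearMap.det (h.val : V →ₗ[ℝ] V) = 1 := by
    rw [← map_mul]
    have : ((h⁻¹).val : V →ₗ[ℝ] V) * (h.val : V →ₗ[ℝ] V) = 1 := by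
      ext v
      have h3 : ((h⁻¹).val * h.val) v = v := by rw [Units.inv_mul]; rfl
      exact h3
    rw [this, map_one]
  rw [inv_eq_of_mul_eq_one_right h2] at h1
  exact h1

namespace SemiProd

variable {H : Subgroup (GLGroup V)} [IsClosed (H : Set (GLGroup V))]

theorem lintegral_haar (μV : Measure V) [μV.IsAddHaarMeasure] (μH : Measure H) [IsRightHaar μH]
    {f : SemiProd H → ℝ≥0∞} (hf : Measurable f) :
    ∫⁻ g, f g ∂(haar μV μH) = ∫⁻ h, ∫⁻ v, f (mk v h) ∂μV ∂μH :=
  lintegral_prod_symm (μ := μV) (ν := μH) f hf.aemeasurable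

theorem lintegral_subHaar (K : Subgroup H) [IsClosed (K : Set H)] (μV : Measure V)
    [μV.IsAddHaarMeasure] (μK : Measure K) [IsRightHaar μK] {f : sub K → ℝ≥0∞}
    (hf : Measurable f) :
    ∫⁻ n, f n ∂(subHaar K μV μK) = ∫⁻ k, ∫⁻ v, f (subMk K (v, k)) ∂μV ∂μK := by
  have : SecondCountableTopology V := secondCountable_of_proper
  have hmk : Measurable (subMk K) := (continuous_subMk K).measurable
  rw [subHaar, lintegral_map hf hmk]
  exact lintegral_prod_symm (fun p => f (subMk K p)) (hf.comp hmk).aemeasurable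

theorem lintegral_affine (μV : Measure V) [μV.IsAddHaarMeasure] (h : GLGroup V) (w : V)
    {f : V → ℝ≥0∞} (hf : Measurable f) :
    ∫⁻ v, f (w + (h⁻¹).val v) ∂μV = ENNReal.ofReal (absDet h) * ∫⁻ v, f v ∂μV := by
  have h1 : Measurable fun v => (h⁻¹).val v := (h⁻¹).val.continuous.measurable
  have h2 : Measurable fun v => f (w + v) := hf.comp (by fun_prop)
  rw [← lintegral_map h2 h1, map_inv_smul, lintegral_smul_measure, smul_eq_mul,
    lintegral_add_left_eq_self]

theorem eq_of_ofReal_mul_eq {a b : ℝ} (ha : 0 < a) (hb : 0 < b) {c : ℝ≥0∞} (hc : c ≠ 0)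
    (hc' : c ≠ ∞) (h : ENNReal.ofReal a * c = ENNReal.ofReal b * c) : a = b := by
  have h1 := (ENNReal.mul_left_inj hc hc').1 h
  exact (ENNReal.ofReal_eq_ofReal_iff ha.le hb.le).1 h1

/-- A single function with finite nonzero integral suffices to read off a modular function from the
way translation scales integrals. -/
theorem exists_test_function {G : Type*} [Group G] [TopologicalSpace G] [IsTopologicalGroup G]
    [LocallyCompactSpace G] [MeasurableSpace G] [BorelSpace G] (μ : Measure G) [IsRightHaar μ] :
    ∃ f : G → ℝ≥0∞, Measurable f ∧ ∫⁻ g, f g ∂μ ≠ 0 ∧ ∫⁻ g, f g ∂μ ≠ ∞ := by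
  obtain ⟨K, hK, hK1⟩ := exists_compact_mem_nhds (1 : G)
  have h1 : MeasurableSet (interior K) := isOpen_interior.measurableSet
  refine ⟨(interior K).indicator 1, measurable_one.indicator h1, ?_, ?_⟩
  · rw [lintegral_indicator_one h1]
    exact (isOpen_interior.measure_pos μ ⟨1, mem_interior_iff_mem_nhds.2 hK1⟩).ne'
  · rw [lintegral_indicator_one h1]
    exact ((measure_mono interior_subset).trans_lt hK.measure_lt_top).ne

/-- The modular function of `V ⋊ H`. -/
theorem modular_mk (μV : Measure V) [μV.IsAddHaarMeasure] (μH : Measure H) [IsRightHaar μH]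
    (v : V) (h : H) : modular (mk v h) = absDet (h : GLGroup V) * modular h := by
  obtain ⟨f, hf, h0, htop⟩ := exists_test_function (haar μV μH)
  refine eq_of_ofReal_mul_eq (modular_pos _) (mul_pos (absDet_pos _) (modular_pos _)) h0 htop ?_
  have hmk : ∀ k : H, Measurable fun w : V => mk w k := fun k => measurable_prodMk_right
  rw [← lintegral_inv_mul_left, lintegral_haar μV μH (f := fun g => f ((mk v h)⁻¹ * g)) (hf.comp (measurable_const_mul _)),
    lintegral_haar μV μH hf, ENNReal.ofReal_mul (absDet_pos _).le, mul_assoc]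
  have h1 := lintegral_inv_mul_left μH (fun k => ∫⁻ w, f (mk w k) ∂μV) h
  rw [← h1, ← lintegral_const_mul' _ _ ENNReal.ofReal_ne_top]
  refine lintegral_congr fun k => ?_
  exact lintegral_affine μV (h : GLGroup V) (mk v h)⁻¹.1 (hf.comp (hmk (h⁻¹ * k)))

theorem modular_subMk (K : Subgroup H) [IsClosed (K : Set H)] (μV : Measure V)
    [μV.IsAddHaarMeasure] (μK : Measure K) [IsRightHaar μK] (v : V) (k : K) :
    modular (subMk K (v, k)) = absDet ((k : H) : GLGroup V) * modular k := by
  have : SecondCountableTopology V := secondCountable_of_proper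
  obtain ⟨f, hf, h0, htop⟩ := exists_test_function (subHaar K μV μK)
  refine eq_of_ofReal_mul_eq (modular_pos _) (mul_pos (absDet_pos _) (modular_pos _)) h0 htop ?_
  have hmk : ∀ k : K, Measurable fun w : V => subMk K (w, k) := fun k =>
    (continuous_subMk K).measurable.comp measurable_prodMk_right
  rw [← lintegral_inv_mul_left, lintegral_subHaar K μV μK (f := fun n => f ((subMk K (v, k))⁻¹ * n))
      (hf.comp (measurable_const_mul _)),
    lintegral_subHaar K μV μK hf, ENNReal.ofReal_mul (absDet_pos _).le, mul_assoc]
  have h1 := lintegral_inv_mul_left μK (fun l => ∫⁻ w, f (subMk K (w, l)) ∂μV) k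
  rw [← h1, ← lintegral_const_mul' _ _ ENNReal.ofReal_ne_top]
  refine lintegral_congr fun l => ?_
  exact lintegral_affine μV ((k : H) : GLGroup V) (mk v (k : H))⁻¹.1 (hf.comp (hmk (k⁻¹ * l)))

variable {K : Subgroup H} [IsClosed (K : Set H)]
variable {q : SemiProd H → ℝ}

/-- The determinant occurs in the modular functions of both semidirect products and cancels in their
quotient. -/
theorem rho_subMk (μV : Measure V) [μV.IsAddHaarMeasure] (μH : Measure H) [IsRightHaar μH]
    (μK : Measure K) [IsRightHaar μK] (hq : IsRhoFunction (sub K) q) (v : V) (k : K) :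
    q (subMk K (v, k) : SemiProd H) = modular k * (modular (k : H))⁻¹ := by
  have h := hq.map_mul (subMk K (v, k)) 1
  rw [mul_one, hq.map_one, mul_one, modular_inv, modular_subMk K μV μK v k] at h
  have h1 : modular ((subMk K (v, k) : sub K) : SemiProd H)
      = absDet ((k : H) : GLGroup V) * modular (k : H) := modular_mk μV μH v k
  rw [h, h1]
  have := (absDet_pos ((k : H) : GLGroup V)).ne'
  field_simp

/-- Since `(v, h) = (v, 1)(0, h)` and `q(v, 1) = 1`, translations do not affect `q`. -/
theorem rho_mk (μV : Measure V) [μV.IsAddHaarMeasure] (μH : Measure H) [IsRightHaar μH]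
    (μK : Measure K) [IsRightHaar μK] (hq : IsRhoFunction (sub K) q) (v : V) (h : H) :
    q (mk v h) = q (mk 0 h) := by
  have h1 : mk v h = (subMk K (v, 1) : SemiProd H) * mk 0 h := by
    refine Prod.ext ?_ (one_mul h).symm
    change v = v + ((1 : H) : GLGroup V).val 0
    simp
  rw [h1, hq.apply_mul, rho_subMk μV μH μK hq, OneMemClass.coe_one, modular_one, modular_one,
    inv_one, one_mul, one_mul]

theorem isRhoFunction_restrict (μV : Measure V) [μV.IsAddHaarMeasure] (μH : Measure H)
    [IsRightHaar μH] (μK : Measure K) [IsRightHaar μK] (hq : IsRhoFunction (sub K) q) :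
    IsRhoFunction K fun h : H => q (mk 0 h) where
  continuous := hq.continuous.comp (Continuous.prodMk_right (0 : V))
  pos h := hq.pos _
  map_one := hq.map_one
  map_mul k h := by
    have h1 : mk 0 ((k : H) * h) = (subMk K (0, k) : SemiProd H) * mk (0 : V) h := by
      refine Prod.ext ?_ rfl
      change (0 : V) = 0 + ((k : H) : GLGroup V).val 0
      simp
    rw [h1, hq.apply_mul, rho_subMk μV μH μK hq, modular_inv]

/-- The measures `d_q` on `(V ⋊ K) \ (V ⋊ H)` and `d_Q` on `K \ H` correspond to each other. -/
theorem lintegral_transversal_eq (μV : Measure V) [μV.IsAddHaarMeasure] (μH : Measure H)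
    [IsRightHaar μH] (μK : Measure K) [IsRightHaar μK] (hq : IsRhoFunction (sub K) q)
    {νq : Measure (RightCosets (sub K))}
    (hνq : IsQuotientMeasure (sub K) (haar μV μH) (subHaar K μV μK) q νq)
    {νQ : Measure (RightCosets K)} (hνQ : IsQuotientMeasure K μH μK (fun h => q (mk 0 h)) νQ)
    {Φ : SemiProd H → ℝ≥0∞} (hΦ : Measurable Φ)
    (hΦN : ∀ (n : sub K) (g : SemiProd H), Φ (n * g) = Φ g) :
    ∫⁻ g, Φ g ∂(transversal (haar μV μH) (subHaar K μV μK) q)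
      = ∫⁻ y : RightCosets K, Φ (mk 0 y.out) ∂νQ := by
  have : SecondCountableTopology V := secondCountable_of_proper
  have hQ := isRhoFunction_restrict μV μH μK hq
  -- The two quotient integrals are compared through the weight `u(v) w(h)`, with `w` a Bruhat
  -- weight for `K` in `H`. Only a finite nonzero integral is needed of `u`, since it cancels at the
  -- end.
  obtain ⟨u, hu, hu0, hut⟩ :
      ∃ f : V → ℝ≥0∞, Measurable f ∧ ∫⁻ v, f v ∂μV ≠ 0 ∧ ∫⁻ v, f v ∂μV ≠ ∞ := by
    refine ⟨(Metric.ball 0 1).indicator 1, measurable_one.indicator measurableSet_ball, ?_, ?_⟩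
    · rw [lintegral_indicator_one measurableSet_ball]
      exact (Metric.measure_ball_pos μV 0 one_pos).ne'
    · rw [lintegral_indicator_one measurableSet_ball]
      exact measure_ball_lt_top.ne
  obtain ⟨w, hw, hw1⟩ := exists_bruhat (N := K) μK
  set c := ∫⁻ v, u v ∂μV
  have hfst : Measurable fun g : SemiProd H => g.1 := measurable_fst
  have hsnd : Measurable fun g : SemiProd H => g.2 := measurable_snd
  have hmk : Measurable fun h : H => mk (0 : V) h := measurable_prodMk_left
  let W : SemiProd H → ℝ≥0∞ := fun g => u g.1 * w g.2
  have hW : Measurable W := (hu.comp hfst).mul (hw.comp hsnd)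
  -- Translation invariance on `V` makes the inner integral independent of `g`, and `w` integrates
  -- to one over `K`.
  have hWN : ∀ g, ∫⁻ n : sub K, W (n * g) ∂(subHaar K μV μK) = c := by
    intro g
    rw [lintegral_subHaar K μV μK (f := fun n => W (n * g)) (hW.comp (by fun_prop))]
    have h1 : ∀ k : K, ∫⁻ v, W ((subMk K (v, k) : SemiProd H) * g) ∂μV = c * w (k * g.2) := by
      intro k
      change ∫⁻ v, u (v + ((k : H) : GLGroup V).val g.1) * w (k * g.2) ∂μV = _
      rw [lintegral_mul_const _ (by fun_prop), lintegral_add_right_eq_self]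
    simp_rw [h1]
    rw [lintegral_const_mul _ (by fun_prop), hw1, mul_one]
  have hΦv : ∀ v h, Φ (mk v h) = Φ (mk 0 h) := by
    intro v h
    have h1 : mk v h = (subMk K (v, 1) : SemiProd H) * mk 0 h := by
      refine Prod.ext ?_ (one_mul h).symm
      change v = v + ((1 : H) : GLGroup V).val 0
      simp
    rw [h1, hΦN]
  have hΦK : ∀ (k : K) (h : H), Φ (mk 0 (k * h)) = Φ (mk 0 h) := by
    intro k h
    rw [← hΦN (subMk K (0, k)) (mk 0 h)]
    congr 1
    refine Prod.ext ?_ rfl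
    change (0 : V) = 0 + ((k : H) : GLGroup V).val 0
    simp
  have hqm : Measurable fun g : SemiProd H => ENNReal.ofReal (q g) :=
    hq.continuous.measurable.ennreal_ofReal
  refine (ENNReal.mul_right_inj hu0 hut).1 ?_
  calc c * ∫⁻ g, Φ g ∂(transversal (haar μV μH) (subHaar K μV μK) q)
      = ∫⁻ g, ∫⁻ n : sub K, W (n * g) * Φ (n * g) ∂(subHaar K μV μK)
          ∂(transversal (haar μV μH) (subHaar K μV μK) q) := by
        rw [← lintegral_const_mul _ hΦ]
        refine lintegral_congr fun g => ?_
        simp_rw [hΦN]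
        have h1 : Measurable fun n : sub K => W (n * g) := hW.comp (by fun_prop)
        rw [lintegral_mul_const _ h1, hWN]
    _ = ∫⁻ g, W g * Φ g * ENNReal.ofReal (q g) ∂(haar μV μH) :=
        lintegral_lintegral_fiber hq hνq (F := fun g => W g * Φ g) (hW.mul hΦ)
    _ = ∫⁻ h, ∫⁻ v, u v * (w h * Φ (mk 0 h) * ENNReal.ofReal (q (mk 0 h))) ∂μV ∂μH := by
        rw [lintegral_haar μV μH (f := fun g => W g * Φ g * ENNReal.ofReal (q g))
          ((hW.mul hΦ).mul hqm)]
        refine lintegral_congr fun h => lintegral_congr fun v => ?_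
        rw [hΦv, rho_mk μV μH μK hq v h]
        change u v * w h * _ * _ = _
        ring
    _ = c * ∫⁻ h, w h * Φ (mk 0 h) * ENNReal.ofReal (q (mk 0 h)) ∂μH := by
        rw [← lintegral_const_mul' _ _ hut]
        refine lintegral_congr fun h => ?_
        rw [lintegral_mul_const _ hu]
    _ = c * ∫⁻ y : RightCosets K, Φ (mk 0 y.out) ∂νQ := by
        rw [← hνQ.lintegral_eq hQ (F := fun h => w h * Φ (mk 0 h)) (hw.mul (hΦ.comp hmk))]
        congr 1
        refine lintegral_congr fun y => ?_
        simp_rw [hΦK]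
        rw [lintegral_mul_const _ (by fun_prop), hw1, one_mul]

end SemiProd

end SemidirectProduct

/-! ### The operators `A(h)` as diagonal values of the kernel. -/

theorem hasCompactSupport_comp_conj {X H : Type*} [TopologicalSpace X] [Group H]
    [TopologicalSpace H] [IsTopologicalGroup H] {K : Subgroup H} [hK : IsClosed (K : Set H)]
    {f : X × H → ℂ} (hf : HasCompactSupport f) (h : H) :
    HasCompactSupport fun p : X × K => f (p.1, h⁻¹ * p.2 * h) := by
  have h1 : Topology.IsClosedEmbedding fun p : X × K => (p.1, (p.2 : H)) :=
    Topology.IsClosedEmbedding.id.prodMap hK.isClosedEmbedding_subtypeVal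
  have h2 : Topology.IsClosedEmbedding fun p : X × H => (p.1, h⁻¹ * p.2 * h) :=
    Topology.IsClosedEmbedding.id.prodMap
      ((Homeomorph.mulLeft h⁻¹).trans (Homeomorph.mulRight h)).isClosedEmbedding
  have h3 := (hf.comp_isClosedEmbedding h2).comp_isClosedEmbedding h1
  exact h3

section FiberOperator

variable {V : Type*} [NormedAddCommGroup V] [NormedSpace ℝ V] [FiniteDimensional ℝ V]
variable [MeasurableSpace V] [BorelSpace V]
variable {H : Subgroup (GLGroup V)} [IsClosed (H : Set (GLGroup V))]
variable {E : Type*} [NormedAddCommGroup E] [InnerProductSpace ℂ E]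

theorem SemiProd.integral_comp_inv_smul {K : Type*} [MeasurableSpace K] (μV : Measure V)
    [μV.IsAddHaarMeasure] (μK : Measure K) [SFinite μK] (h : GLGroup V) (f : V × K → ℂ) :
    ∫ p, f ((h⁻¹).val p.1, p.2) ∂(μV.prod μK) = absDet h * ∫ p, f p ∂(μV.prod μK) := by
  let L : V ≃ₜ V := (ContinuousLinearEquiv.unitsEquiv ℝ V h⁻¹).toHomeomorph
  let e : V × K ≃ᵐ V × K := L.toMeasurableEquiv.prodCongr (MeasurableEquiv.refl K)
  have h1 : (μV.prod μK).map e = ENNReal.ofReal (absDet h) • μV.prod μK := by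
    have h2 : μV.map L = ENNReal.ofReal (absDet h) • μV := map_inv_smul μV h
    have h3 := Measure.map_prod_map μV μK (f := L) (g := id) L.continuous.measurable measurable_id
    rw [h2, Measure.map_id, Measure.prod_smul_left] at h3
    exact h3.symm
  have h4 := integral_map_equiv (μ := μV.prod μK) e f
  rw [h1, integral_smul_measure, ENNReal.toReal_ofReal (absDet_pos h).le, Complex.real_smul] at h4
  exact h4.symm

/-- The diagonal values of the kernel of `π(ψ)` are the operators `A(h)`. -/
theorem inner_fiberOperator [CompleteSpace E] {χ : Character V} (ρ : UnitaryRep (χ.stab H) E)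
    (μV : Measure V) [μV.IsAddHaarMeasure] (μH : Measure H) [IsRightHaar μH]
    (μχ : Measure (χ.stab H)) [IsRightHaar μχ]
    {q : SemiProd H → ℝ} (hq : IsRhoFunction (SemiProd.sub (χ.stab H)) q)
    {ψ : SemiProd H → ℂ} (hψ : Continuous ψ) (hψc : HasCompactSupport ψ) (h : H) (e : E) :
    inner ℂ e (fiberOperator μV χ μχ ρ ψ h e)
      = ((absDet (h : GLGroup V))⁻¹ : ℝ) *
        fiberForm (SemiProd.subHaar (χ.stab H) μV μχ) q (χ.tensor ρ) ψ (SemiProd.mk 0 h) e := by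
  have : SecondCountableTopology V := secondCountable_of_proper
  let r : χ.stab H → ℝ := fun h₀ => (Real.sqrt (q (SemiProd.mk 0 (h₀ : H))))⁻¹
  -- The half powers of the two modular functions are precisely `q(n)^{-1/2}` on the subgroup.
  have hr : ∀ h₀ : χ.stab H,
      modular (h₀ : H) ^ (1 / 2 : ℝ) * modular h₀ ^ (-(1 / 2) : ℝ) = r h₀ := by
    intro h₀
    have h1 : q (SemiProd.mk 0 (h₀ : H)) = modular h₀ * (modular (h₀ : H))⁻¹ :=
      SemiProd.rho_subMk μV μH μχ hq 0 h₀
    have h2 := modular_pos h₀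
    have h3 := modular_pos (h₀ : H)
    simp only [r]
    rw [h1, Real.sqrt_mul h2.le, Real.sqrt_inv, Real.rpow_neg h2.le, ← Real.sqrt_eq_rpow,
      ← Real.sqrt_eq_rpow, mul_inv, inv_inv, mul_comm]
  have hrc : Continuous r := by
    have h1 : Continuous fun h₀ : χ.stab H => q (SemiProd.mk 0 (h₀ : H)) :=
      hq.continuous.comp ((Continuous.prodMk_right (0 : V)).comp continuous_subtype_val)
    exact (Real.continuous_sqrt.comp h1).inv₀ fun h₀ => (Real.sqrt_pos.2 (hq.pos _)).ne'
  let B : V × χ.stab H → ℂ := fun p =>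
    ψ (SemiProd.mk p.1 (h⁻¹ * p.2 * h)) * ((χ.twist h).eval p.1 : ℂ) * (r p.2 : ℂ)
  have hψ1 : Continuous fun p : V × χ.stab H => ψ (SemiProd.mk p.1 (h⁻¹ * p.2 * h)) := by
    have h1 : Continuous fun p : V × χ.stab H => (p.1, h⁻¹ * (p.2 : H) * h) := by fun_prop
    exact hψ.comp h1
  have hBc : Continuous B := by
    have h2 : Continuous fun p : V × χ.stab H => ((χ.twist h).eval p.1 : ℂ) :=
      continuous_subtype_val.comp ((χ.twist h).continuous_eval.comp continuous_fst)
    exact (hψ1.mul h2).mul (Complex.continuous_ofReal.comp (hrc.comp continuous_snd))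
  have hBs : HasCompactSupport B := by
    have h3 := hasCompactSupport_comp_conj (K := χ.stab H)
      (f := fun p : V × H => ψ (SemiProd.mk p.1 p.2)) hψc h
    exact h3.mul_right.mul_right
  have hρ : Continuous fun p : V × χ.stab H => ρ p.2 e := (ρ.continuous_apply e).comp continuous_snd
  have hi : Integrable (fun p => B p • ρ p.2 e) (μV.prod μχ) :=
    (hBc.smul hρ).integrable_of_hasCompactSupport hBs.smul_right
  have h1 : fiberOperator μV χ μχ ρ ψ h e = ∫ p, B p • ρ p.2 e ∂(μV.prod μχ) := by
    rw [integral_prod _ hi]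
    simp only [fiberOperator, hr, B]
  have h2 : fiberForm (SemiProd.subHaar (χ.stab H) μV μχ) q (χ.tensor ρ) ψ (SemiProd.mk 0 h) e
      = ∫ p, (fun p : V × χ.stab H => B p * inner ℂ e (ρ p.2 e))
          (((h : GLGroup V)⁻¹).val p.1, p.2) ∂(μV.prod μχ) := by
    rw [fiberForm, SemiProd.subHaar]
    refine ((SemiProd.subHomeo (χ.stab H)).measurableEmbedding.integral_map _).trans ?_
    refine integral_congr_ae (Filter.Eventually.of_forall fun p => ?_)
    -- Conjugation by `(0, h)` acts on the `V`-component by `h⁻¹`. Replacing `v` by `h v` therefore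
    -- turns `χ` into `χ · h` and contributes the factor `|det h|`.
    have h3 : (SemiProd.mk 0 h)⁻¹ * (SemiProd.subMk (χ.stab H) p : SemiProd H) * SemiProd.mk 0 h
        = SemiProd.mk (((h : GLGroup V)⁻¹).val p.1) (h⁻¹ * (p.2 : H) * h) := by
      refine Prod.ext ?_ rfl
      change -((h : GLGroup V)⁻¹).val (0 : V) + ((h : GLGroup V)⁻¹).val p.1
        + ((h⁻¹ * p.2 : H) : GLGroup V).val (0 : V) = ((h : GLGroup V)⁻¹).val p.1
      simp
    have h4 : q (SemiProd.subMk (χ.stab H) p : SemiProd H) = q (SemiProd.mk 0 (p.2 : H)) :=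
      SemiProd.rho_mk μV μH μχ hq p.1 p.2
    have h5 : (χ.twist h).eval (((h : GLGroup V)⁻¹).val p.1) = χ.eval p.1 := by
      rw [Character.eval_twist]
      congr 1
      have h6 : ((h : GLGroup V).val * ((h : GLGroup V)⁻¹).val) p.1 = p.1 := by
        rw [Units.mul_inv]; rfl
      exact h6
    have h7 : (χ.tensor ρ) (SemiProd.subMk (χ.stab H) p) e = (χ.eval p.1 : ℂ) • ρ p.2 e := rfl
    change ψ ((SemiProd.mk 0 h)⁻¹ * (SemiProd.subMk (χ.stab H) p : SemiProd H) * SemiProd.mk 0 h)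
      * ((Real.sqrt (q (SemiProd.subMk (χ.stab H) p : SemiProd H)))⁻¹ : ℝ)
      * inner ℂ e ((χ.tensor ρ) (SemiProd.subMk (χ.stab H) p) e) = _
    rw [h3, h4, h7, inner_smul_right]
    simp only [B, h5, r]
    ring
  rw [h1, ← integral_inner hi, h2,
    SemiProd.integral_comp_inv_smul μV μχ (h : GLGroup V)
      (fun p : V × χ.stab H => B p * inner ℂ e (ρ p.2 e)), ← mul_assoc,
    ← Complex.ofReal_mul, inv_mul_cancel₀ (absDet_pos _).ne', Complex.ofReal_one, one_mul]
  simp_rw [inner_smul_right]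

end FiberOperator

end Mackey

/-! ### Assembly of the trace formula for `V ⋊ H`. -/

open Mackey MeasureTheory in
theorem theorem3p1 {V : Type*} [NormedAddCommGroup V] [NormedSpace ℝ V] [FiniteDimensional ℝ V]
    [MeasurableSpace V] [BorelSpace V]
    (H : Subgroup (GLGroup V)) [IsClosed (H : Set (GLGroup V))] (χ : Character V)
    {E : Type*} [NormedAddCommGroup E] [InnerProductSpace ℂ E] [CompleteSpace E]
    (ρ : UnitaryRep (χ.stab H) E) (hρ : ρ.IsIrreducible)
    (μV : Measure V) [μV.IsAddHaarMeasure] (μH : Measure H) [IsRightHaar μH]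
    (μχ : Measure (χ.stab H)) [IsRightHaar μχ]
    (q : SemiProd H → ℝ) (hq : IsRhoFunction (SemiProd.sub (χ.stab H)) q)
    (νq : Measure (RightCosets (SemiProd.sub (χ.stab H))))
    (hνq : IsQuotientMeasure (SemiProd.sub (χ.stab H)) (SemiProd.haar μV μH)
      (SemiProd.subHaar (χ.stab H) μV μχ) q νq)
    (Q : H → ℝ) (hQ : ∀ h : H, Q h = q (SemiProd.mk 0 h))
    (νQ : Measure (RightCosets (χ.stab H)))
    (hνQ : IsQuotientMeasure (χ.stab H) μH μχ Q νQ)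
    (φ : SemiProd H → ℂ) (hφ : Continuous φ) (hφc : HasCompactSupport φ)
    (ψ : SemiProd H → ℂ) (hψ : ψ = conv (SemiProd.haar μV μH) φ (involution φ)) :
    (∀ f, Integrable (fun g => ψ g • inducedRep (χ.tensor ρ) hq hνq g f) (SemiProd.haar μV μH)) ∧
    IsPositiveOp (integrated (SemiProd.haar μV μH) (inducedRep (χ.tensor ρ) hq hνq) ψ) ∧
    (∀ h : H, IsPositiveOp (fiberOperator μV χ μχ ρ ψ h)) ∧
    ∃ F : RightCosets (χ.stab H) → ENNReal, Measurable F ∧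
      (∀ h : H, F (coset (χ.stab H) h) =
        ENNReal.ofReal ((modular h)⁻¹ * (Q h)⁻¹) * posTrace (fiberOperator μV χ μχ ρ ψ h)) ∧
      posTrace (integrated (SemiProd.haar μV μH) (inducedRep (χ.tensor ρ) hq hνq) ψ)
        = ∫⁻ x, F x ∂νQ := by
  have hQ' : Q = fun h => q (SemiProd.mk 0 h) := funext hQ
  subst hQ' hψ
  have hE : TopologicalSpace.SeparableSpace E := hρ.separableSpace
  have hφi : Integrable φ (SemiProd.haar μV μH) := hφ.integrable_of_hasCompactSupport hφc
  have hψ : Continuous (conv (SemiProd.haar μV μH) φ (involution φ)) :=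
    continuous_conv_involution _ hφ hφc
  have hψc : HasCompactSupport (conv (SemiProd.haar μV μH) φ (involution φ)) :=
    hasCompactSupport_conv_involution _ hφc
  have hπ := stronglyMeasurable_inducedRep (γ := χ.tensor ρ) hq hνq
  have hA := inner_fiberOperator ρ μV μH μχ hq hψ hψc
  have hdet : ∀ h : H, 0 < (absDet (h : GLGroup V))⁻¹ := fun h => inv_pos.2 (absDet_pos _)
  obtain ⟨Φ, hΦ, hΦN, hΦA, htr⟩ := exists_trace_density hq hνq (χ.tensor ρ) hφ hφc
  have hΦK : ∀ (k : χ.stab H) (h : H), Φ (SemiProd.mk 0 (k * h)) = Φ (SemiProd.mk 0 h) := by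
    intro k h
    rw [← hΦN (SemiProd.subMk (χ.stab H) (0, k)) (SemiProd.mk 0 h)]
    congr 1
    refine Prod.ext ?_ rfl
    change (0 : V) = 0 + ((k : H) : GLGroup V).val 0
    simp
  have hmk : Measurable fun h : H => SemiProd.mk (0 : V) h := measurable_prodMk_left
  refine ⟨integrable_smul_rep _ hπ (hψ.integrable_of_hasCompactSupport hψc),
    isPositiveOp_integrated_conv _ hπ hφi hφ.stronglyMeasurable,
    fun h => isPositiveOp_of_fiberForm hq hνq hφ hφc (hdet h) (hA h),
    fun y => Φ (SemiProd.mk 0 y.out),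
    measurable_out (F := fun h => Φ (SemiProd.mk 0 h)) hΦK (hΦ.comp hmk), fun h => ?_, ?_⟩
  · beta_reduce
    rw [apply_out_coset (F := fun h => Φ (SemiProd.mk 0 h)) hΦK, hΦA _ _ _ (hdet h) (hA h),
      SemiProd.modular_mk μV μH, ← mul_assoc,
      ← ENNReal.ofReal_mul (mul_pos (inv_pos.2 (modular_pos h)) (inv_pos.2 (hq.pos _))).le]
    -- The scale `|det h|⁻¹` of `A(h)` cancels the determinant in `Δ_G(0, h)`; what remains, `Δ_H(h)
    -- Q(h)`, is undone by the normalising factor of the theorem.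
    have h1 : (modular h)⁻¹ * (q (SemiProd.mk 0 h))⁻¹ * ((absDet (h : GLGroup V))⁻¹ *
        (absDet (h : GLGroup V) * modular h) * q (SemiProd.mk 0 h)) = 1 := by
      have h2 := (absDet_pos (h : GLGroup V)).ne'
      have h3 := (modular_pos h).ne'
      have h4 := (hq.pos (SemiProd.mk 0 h)).ne'
      field_simp
    rw [h1, ENNReal.ofReal_one, one_mul]
  · rw [htr, SemiProd.lintegral_transversal_eq μV μH μχ hq hνq hνQ hΦ hΦN]
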